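/- Let $V$ be a finite-dimensional real inner product space (e.g. $\mathbb R^D$) of dimension $D$. A linear constraint $\langle\alpha|c\rangle$ (with $\alpha\in V$, $c\in\mathbb R$) is satisfied by $b\in V$ if $\alpha\cdot b\ge c$; it supports $b$ if $\alpha\neq 0$ and $\alpha\cdot b=c$. For a set $S$ of constraints, $\mathrm{sat}(S)$ is the set of points satisfying all of them; two (combinations of) constraints are identified if they have the same $\mathrm{sat}$. A representation of a constraint is a finite set of linear constraints whose $\mathrm{sat}$ is the same, and it is minimal if it has the smallest possible number of elements. A constraint is non-degenerate if its $\mathrm{sat}$ is nonempty with affine span $V$. A $K$-face of a closed convex set $\mathcal C$ is a nonempty convex subset $\mathcal F\subseteq\mathcal C$ with affine dimension $K$ such that whenever $\mu\eta_1+(1-\mu)\eta_2\in\mathcal F$ with $\eta_1,\eta_2\in\mathcal C$, $\mu\in(0,1)$, then $\eta_1,\eta_2\in\mathcal F$; a vertex is the point of a $0$-face, a facet is a $(D-1)$-face. Let $\Omega=\sum_{i\in I}\langle\alpha_i|c_i\rangle$ be a finite combination of constraints with $c_i\in\{1,0,-1\}$, and let $I_c=\{i\in I: c_i=c\}$. Assume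 that $\alpha_i=0$ for some $i\in I_{-1}$ and that $\alpha_i\ne 0$ for all $i\in I_0$. Let $\mathrm{rel}(\Omega)$ be a minimal representation of $\Omega$; membership in it is understood up to normalisation (i.e. up to equality of constraints). For real $c$ let $$\mathrm{reg}_c(\Omega)=\Big\{\sum_{i\in I}\lambda_i\alpha_i:\ \lambda_i\ge 0,\ \sum_{i\in I}\lambda_ic_i\ge c\Big\}.$$ Fix an integer $p>1$. For a sign $s\in\{1,-1\}$ let $P_s=\{\alpha_i: i\in I_s\}$, let $H_s$ be the convex hull of $$P_s\cup\{\alpha_i+(p-1)\alpha_j: i\in I_s,\ j\in I_0\}\cup\{p\alpha_i+(p-1)\alpha_j: i\in I_s,\ j\in I_{-s}\},$$ let $\{\langle n_\ell|r_\ell\rangle\}_{\ell\in L_s}$ be a minimal representation of the constraint with solution set $H_s$, let $M_s\subseteq L_s$ consist of those $\ell$ for which $\langle n_\ell|r_\ell\rangle$ supports at least one point of $P_s$, and let $\mho_s=\sum_{\ell\in M_s}\langle n_\ell|r_\ell\rangle$. The sign $s=-1$ is always considered, and the sign $s=1$ is considered if and only if $I_1\ne\emptyset$. Suppose that $\Omega$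 is non-degenerate and that $\mho_s$ is non-degenerate for every considered sign $s$. Then: 1. For every considered $s$ and every $i\in I_s$: $\langle\alpha_i|s\rangle\in\mathrm{rel}(\Omega)$ if and only if $\alpha_i\ne 0$ and $\alpha_i$ is a vertex of $\mathrm{reg}_s(\Omega)$. Every vertex of $\mathrm{reg}_s(\Omega)$ other than $0$ is $\alpha_i$ for some $i\in I_s$, and every element of $\mathrm{rel}(\Omega)$ whose right-hand side has the sign $s$ is, up to normalisation, $\langle\alpha_i|s\rangle$ for some $i\in I_s$. 2. For every considered $s$ and every $\ell\in L_s$ with $r_\ell\ne 0$: $\frac1{|r_\ell|}n_\ell$ is a vertex of $\mathrm{sat}(\Omega)$ if and only if $\ell\in M_s$. Every vertex of $\mathrm{sat}(\Omega)$ other than $0$ equals $\frac1{|r_\ell|}n_\ell$ for some considered $s$ and some $\ell\in M_s$ with $r_\ell\neq 0$. 3. For every considered $s$ and every $\ell\in L_s$: $\{\beta\in\mathrm{reg}_s(\Omega): n_\ell\cdot\beta=r_\ell\}$ is a facet of $\mathrm{reg}_s(\Omega)$ if and only if $\ell\in M_s$. Every facet of $\mathrm{reg}_s(\Omega)$ is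 of this form with $\ell\in M_s$. 4. For every linear constraint $\langle\alpha|c\rangle$: $\langle\alpha|c\rangle\in\mathrm{rel}(\Omega)$ if and only if $\mathrm{sat}(\Omega)\subseteq\mathrm{sat}(\langle\alpha|c\rangle)$ and $\{b\in\mathrm{sat}(\Omega):\alpha\cdot b=c\}$ is a facet of $\mathrm{sat}(\Omega)$. Every facet of $\mathrm{sat}(\Omega)$ is of this form with $\langle\alpha|c\rangle\in\mathrm{rel}(\Omega)$. -/

import Mathlib

/-- The pair `⟨α|c⟩`, standing for the linear constraint `α · b ≥ c` on points `b`. -/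
structure LinearConstraint (V : Type*) where
  /-- the coefficient vector `α` -/
  normal : V
  /-- the right-hand side `c` -/
  offset : ℝ

namespace LinearConstraint

variable {V : Type*} [NormedAddCommGroup V] [InnerProductSpace ℝ V]

/-- The set of points that satisfy every constraint in `S`. -/
def sat (S : Set (LinearConstraint V)) : Set V :=
  {b | ∀ A ∈ S, A.offset ≤ inner ℝ A.normal b}

/-- `⟨α|c⟩` supports `b` if `α ≠ 0` and `α · b = c`. -/
def Supports (A : LinearConstraint V) (b : V) : Prop :=
  A.normal ≠ 0 ∧ inner ℝ A.normal b = A.offset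

/-- The points of `X` at which `A` holds with equality. -/
def tightSet (X : Set V) (A : LinearConstraint V) : Set V :=
  {x ∈ X | inner ℝ A.normal x = A.offset}

/-- A finite set `R` of linear constraints is a minimal representation of the constraint with
solution set `X` if it represents it and no representation has fewer elements. -/
def IsMinimalRepresentation (R : Finset (LinearConstraint V)) (X : Set V) : Prop :=
  sat (R : Set (LinearConstraint V)) = X ∧
    ∀ R' : Finset (LinearConstraint V), sat (R' : Set (LinearConstraint V)) = X → R.card ≤ R'.card

/-- `A` belongs to `R` up to normalisation: some element of `R` is the same constraint as `A`,
i.e. is satisfied by the same points. -/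
def MemUpToNormalisation (A : LinearConstraint V) (R : Finset (LinearConstraint V)) : Prop :=
  ∃ B ∈ R, sat {B} = sat {A}

/-- The dimension of the affine span of `X` (used for nonempty `X`). -/
noncomputable def affDim (X : Set V) : ℕ :=
  Module.finrank ℝ (vectorSpan ℝ X)

/-- A constraint with solution set `X` is non-degenerate if it is satisfiable and `X` has full
dimension. -/
def Nondegenerate (X : Set V) : Prop :=
  X.Nonempty ∧ affDim X = Module.finrank ℝ V

/-- `F` is a `K`-face of the (closed convex) set `C`. -/
def IsKFace (K : ℕ) (F C : Set V) : Prop :=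
  F.Nonempty ∧ Convex ℝ F ∧ F ⊆ C ∧ affDim F = K ∧
    ∀ φ ∈ F, ∀ η₁ ∈ C, ∀ η₂ ∈ C, ∀ μ : ℝ, 0 < μ → μ < 1 →
      φ = μ • η₁ + (1 - μ) • η₂ → η₁ ∈ F ∧ η₂ ∈ F

/-- A vertex is the single point of a 0-face. -/
def IsVertex (v : V) (C : Set V) : Prop :=
  IsKFace 0 {v} C

/-- A facet is a `(D - 1)`-face, where `D` is the dimension of the ambient space. -/
def IsFacet (F C : Set V) : Prop :=
  ∃ K : ℕ, K + 1 = Module.finrank ℝ V ∧ IsKFace K F C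

variable {ι : Type*}

/-- `reg_c(Ω)`: all `∑ λᵢ αᵢ` with `λᵢ ≥ 0` and `∑ λᵢ cᵢ ≥ c`, for `Ω = ∑ ⟨αᵢ|cᵢ⟩`. -/
def reg [Fintype ι] (c : ℝ) (Ω : ι → LinearConstraint V) : Set V :=
  {β | ∃ w : ι → ℝ, (∀ i, 0 ≤ w i) ∧ c ≤ ∑ i, w i * (Ω i).offset ∧
    β = ∑ i, w i • (Ω i).normal}

/-- The points `αᵢ` with `cᵢ = s`, where `s = ±1`. -/
def pointsP (Ω : ι → LinearConstraint V) (s : ℝ) : Set V :=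
  {x | ∃ i, (Ω i).offset = s ∧ x = (Ω i).normal}

/-- The points `αᵢ + (p - 1) αⱼ` with `cᵢ = s`, `cⱼ = 0`. -/
def pointsZ (Ω : ι → LinearConstraint V) (p : ℕ) (s : ℝ) : Set V :=
  {x | ∃ i j, (Ω i).offset = s ∧ (Ω j).offset = 0 ∧
    x = (Ω i).normal + ((p : ℝ) - 1) • (Ω j).normal}

/-- The points `p αᵢ + (p - 1) αⱼ` with `cᵢ = s`, `cⱼ = -s`. -/
def pointsN (Ω : ι → LinearConstraint V) (p : ℕ) (s : ℝ) : Set V :=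
  {x | ∃ i j, (Ω i).offset = s ∧ (Ω j).offset = -s ∧
    x = (p : ℝ) • (Ω i).normal + ((p : ℝ) - 1) • (Ω j).normal}

/-- The polytope `H^{(p)}_s`. -/
def hullH (Ω : ι → LinearConstraint V) (p : ℕ) (s : ℝ) : Set V :=
  convexHull ℝ (pointsP Ω s ∪ pointsZ Ω p s ∪ pointsN Ω p s)

/-- Given a representation `L` of `H^{(p)}_s`, the subset `M^{(p)}_s` of those elements that support
at least one of the points `αᵢ` with `cᵢ = s`. The constraint `℧_s` is the combination of these. -/
def setM (Ω : ι → LinearConstraint V) (s : ℝ) (L : Finset (LinearConstraint V)) :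
    Set (LinearConstraint V) :=
  {A | A ∈ L ∧ ∃ x ∈ pointsP Ω s, A.Supports x}

/-- The signs that are considered: `-1` always, and `1` unless no `cᵢ` equals `1`. -/
def signs (Ω : ι → LinearConstraint V) : Set ℝ :=
  {s | s = -1 ∨ (s = 1 ∧ ∃ i, (Ω i).offset = 1)}

end LinearConstraint

/-! Everything is read off one polyhedral cone in V × ℝ, generated by the pairs (αᵢ, cᵢ). Since (0,
-1) is a generator, the inequality defining `reg` can be turned into an equality
(`exists_eq_of_mem_reg`), so reg_s(Ω) is the slice of the cone at height s. A point b lies in sat(Ω)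
exactly when the functional (x, c) ↦ b·x - c is nonnegative on the cone. A facet of the cone meeting
a generator of height s (`IsConeFacet`) is cut out by some n·x - q c; it gives the facet n·x = s q
of reg_s(Ω) and, if q > 0, the vertex n/q of sat(Ω). Dually, a nonzero vertex of reg_s(Ω) spans an
extreme ray (`IsVertex.eq_smul_of_add`), and the affine Farkas lemma turns extremality into
irredundancy in Ω.

H_s is a bounded piece of reg_s(Ω): the points P_s, and these points moved by p - 1 steps along αⱼ
(cⱼ = 0) or αᵢ + αⱼ (cⱼ = -s). An inequality valid on H_s and tight at a point of P_s is valid on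
these directions, hence on the cone (`isConeFacet_of_spansHyperplane_hullH`). An inequality valid on
the cone but strict on P_s is strict on all of H_s (`mem_setM_of_forall_le`). So M_s selects
precisely the genuine facets. Non-degeneracy of ℧_s serves to give H_s an interior
(`interior_hullH_nonempty`).

Dimension counts are replaced by `SpansHyperplane`, which passes between H_s, reg_s(Ω) and the cone
by evaluating functionals on tight points. -/

namespace LinearConstraint

variable {V : Type*} [NormedAddCommGroup V] [InnerProductSpace ℝ V]

open Topology

/-! ### Solution sets: convexity, interior points and strictness -/

theorem convex_sat (S : Set (LinearConstraint V)) : Convex ℝ (sat S) := by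
  intro x hx y hy a b ha hb hab A hA
  rw [inner_add_right, real_inner_smul_right, real_inner_smul_right]
  calc A.offset = a * A.offset + b * A.offset := by rw [← add_mul, hab, one_mul]
    _ ≤ _ := add_le_add (mul_le_mul_of_nonneg_left (hx A hA) ha)
        (mul_le_mul_of_nonneg_left (hy A hA) hb)

theorem convex_tightSet {X : Set V} (hX : Convex ℝ X) (A : LinearConstraint V) :
    Convex ℝ (tightSet X A) := by
  intro x hx y hy a b ha hb hab
  refine ⟨hX hx.1 hy.1 ha hb hab, ?_⟩
  rw [inner_add_right, real_inner_smul_right, real_inner_smul_right, hx.2, hy.2, ← add_mul, hab,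
    one_mul]

theorem mem_sat_singleton {A : LinearConstraint V} {b : V} :
    b ∈ sat {A} ↔ A.offset ≤ inner ℝ A.normal b := by
  simp [sat]

theorem sat_subset_sat_singleton {S : Set (LinearConstraint V)} {A : LinearConstraint V}
    (hA : A ∈ S) : sat S ⊆ sat {A} :=
  fun _ hb => mem_sat_singleton.2 (hb A hA)

theorem isOpen_strict (R : Finset (LinearConstraint V)) :
    IsOpen {x : V | ∀ A ∈ R, A.offset < inner ℝ A.normal x} := by
  have : {x : V | ∀ A ∈ R, A.offset < inner ℝ A.normal x} =
      ⋂ A ∈ R, {x : V | A.offset < inner ℝ A.normal x} := by ext; simp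
  rw [this]
  exact isOpen_biInter_finset fun A _ => isOpen_lt (by fun_prop) (by fun_prop)

theorem mem_interior_sat_of_strict {R : Finset (LinearConstraint V)} {x : V}
    (hx : ∀ A ∈ R, A.offset < inner ℝ A.normal x) :
    x ∈ interior (sat (R : Set (LinearConstraint V))) :=
  mem_interior.2 ⟨_, fun _ hy A hA => (hy A hA).le, isOpen_strict R, hx⟩

theorem exists_pos_add_smul_mem {U : Set V} {x : V} (hU : U ∈ 𝓝 x) (u : V) :
    ∃ ε : ℝ, 0 < ε ∧ x + ε • u ∈ U := by
  have h : Filter.Tendsto (fun ε : ℝ => x + ε • u) (𝓝[>] 0) (𝓝 x) := by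
    have : ContinuousAt (fun ε : ℝ => x + ε • u) 0 := by fun_prop
    have h := this.tendsto
    simp only [zero_smul, add_zero] at h
    exact h.mono_left nhdsWithin_le_nhds
  obtain ⟨ε, h1, h2⟩ := ((h.eventually hU).and self_mem_nhdsWithin).exists
  exact ⟨ε, h2, h1⟩

theorem lt_of_mem_interior {X : Set V} {A : LinearConstraint V} (hA : A.normal ≠ 0)
    (hX : X ⊆ sat {A}) {x : V} (hx : x ∈ interior X) : A.offset < inner ℝ A.normal x := by
  obtain ⟨ε, hε, h⟩ := exists_pos_add_smul_mem (mem_interior_iff_mem_nhds.1 hx) (-A.normal)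
  have h := mem_sat_singleton.1 (hX h)
  rw [inner_add_right, real_inner_smul_right, inner_neg_right] at h
  have : 0 < inner ℝ A.normal A.normal := real_inner_self_pos.2 hA
  nlinarith

theorem Nondegenerate.interior_nonempty [FiniteDimensional ℝ V] {X : Set V}
    (hX : Nondegenerate X) (hc : Convex ℝ X) : (interior X).Nonempty := by
  rw [hc.interior_nonempty_iff_affineSpan_eq_top,
    AffineSubspace.affineSpan_eq_top_iff_vectorSpan_eq_top_of_nonempty ℝ V V hX.1]
  exact Submodule.eq_top_of_finrank_eq hX.2

/-- A convex set has a point at which every weakly valid constraint is strict, except for those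
that are tight on the whole set. -/
theorem exists_mem_strict_or_tight {X : Set V} (hc : Convex ℝ X) (hne : X.Nonempty)
    (R : Finset (LinearConstraint V)) (hX : X ⊆ sat (R : Set (LinearConstraint V))) :
    ∃ x ∈ X, ∀ A ∈ R, A.offset < inner ℝ A.normal x ∨ ∀ y ∈ X, inner ℝ A.normal y = A.offset := by
  classical
  induction R using Finset.induction_on with
  | empty => exact ⟨hne.some, hne.some_mem, by simp⟩
  | insert A R _ ih =>
    obtain ⟨x, hx, h⟩ := ih fun y hy B hB =>
      hX hy B (Finset.mem_coe.2 (Finset.mem_insert_of_mem hB))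
    have hA : ∀ y ∈ X, A.offset ≤ inner ℝ A.normal y := fun y hy =>
      hX hy A (Finset.mem_coe.2 (Finset.mem_insert_self A R))
    by_cases hy : ∃ y ∈ X, A.offset < inner ℝ A.normal y
    · obtain ⟨y, hy, hAy⟩ := hy
      -- The midpoint inherits every strict inequality of either endpoint.
      refine ⟨(1 / 2 : ℝ) • x + (1 / 2 : ℝ) • y,
        hc hx hy (by norm_num) (by norm_num) (by norm_num), fun B hB => ?_⟩
      rw [inner_add_right, real_inner_smul_right, real_inner_smul_right]
      rcases Finset.mem_insert.1 hB with rfl | hB'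
      · left; linarith [hA x hx]
      · refine (h B hB').imp (fun hs => ?_) id
        have := hX hy B (Finset.mem_coe.2 hB)
        linarith
    · push Not at hy
      refine ⟨x, hx, fun B hB => ?_⟩
      rcases Finset.mem_insert.1 hB with rfl | hB'
      · exact Or.inr fun y hy' => le_antisymm (hy y hy') (hA y hy')
      · exact h B hB'

/-! ### Minimal representations and uniqueness up to positive multiples -/

theorem IsMinimalRepresentation.exists_violating {R : Finset (LinearConstraint V)} {X : Set V}
    (hR : IsMinimalRepresentation R X) {A : LinearConstraint V} (hA : A ∈ R) :
    ∃ y : V, (∀ B ∈ R, B ≠ A → B.offset ≤ inner ℝ B.normal y) ∧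
      inner ℝ A.normal y < A.offset := by
  classical
  by_contra! h
  have : sat ((R.erase A : Finset _) : Set (LinearConstraint V)) = X := by
    rw [← hR.1]
    ext y
    constructor
    · intro hy B hB
      have hy' : ∀ C ∈ R, C ≠ A → C.offset ≤ inner ℝ C.normal y := fun C hC hCA =>
        hy C (Finset.mem_coe.2 (Finset.mem_erase.2 ⟨hCA, hC⟩))
      by_cases hBA : B = A
      · exact hBA ▸ h y hy'
      · exact hy' B hB hBA
    · exact fun hy B hB => hy B (Finset.mem_of_mem_erase hB)
  have h1 := hR.2 _ this
  have h2 := Finset.card_erase_lt_of_mem hA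
  omega

theorem IsMinimalRepresentation.normal_ne_zero {R : Finset (LinearConstraint V)} {X : Set V}
    (hR : IsMinimalRepresentation R X) (hX : X.Nonempty) {A : LinearConstraint V} (hA : A ∈ R) :
    A.normal ≠ 0 := by
  intro h0
  obtain ⟨y, -, hy⟩ := hR.exists_violating hA
  obtain ⟨x, hx⟩ := hX
  rw [← hR.1] at hx
  have := hx A hA
  rw [h0, inner_zero_left] at this hy
  linarith

/-- A linear functional that is constant on `F` is a multiple of `n`. -/
def SpansHyperplane (F : Set V) (n : V) : Prop :=
  ∀ (u : V) (k : ℝ), (∀ x ∈ F, inner ℝ u x = k) → ∃ t : ℝ, u = t • n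

/-- `B` is a positive multiple of `A`. -/
def IsPosMultiple (B A : LinearConstraint V) : Prop :=
  ∃ t : ℝ, 0 < t ∧ B.normal = t • A.normal ∧ B.offset = t * A.offset

theorem IsPosMultiple.sat_eq {A B : LinearConstraint V} (h : IsPosMultiple B A) :
    sat {B} = sat {A} := by
  obtain ⟨t, ht, hn, ho⟩ := h
  ext b
  rw [mem_sat_singleton, mem_sat_singleton, hn, ho, real_inner_smul_left,
    mul_le_mul_iff_right₀ ht]

theorem IsPosMultiple.tightSet_eq {A B : LinearConstraint V} (h : IsPosMultiple B A) (X : Set V) :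
    tightSet X B = tightSet X A := by
  obtain ⟨t, ht, hn, ho⟩ := h
  ext b
  simp only [tightSet, Set.mem_ofPred_eq]
  rw [hn, ho, real_inner_smul_left, mul_right_inj' ht.ne']

theorem IsPosMultiple.symm {A B : LinearConstraint V} (h : IsPosMultiple B A) :
    IsPosMultiple A B := by
  obtain ⟨t, ht, hn, ho⟩ := h
  refine ⟨t⁻¹, inv_pos.2 ht, ?_, ?_⟩
  · rw [hn, smul_smul, inv_mul_cancel₀ ht.ne', one_smul]
  · rw [ho, ← mul_assoc, inv_mul_cancel₀ ht.ne', one_mul]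

/-- The segment from an interior point to a point violating only `A` crosses the hyperplane of `A`
where all other constraints are strict. Near that point the whole hyperplane lies in `X`, so a
functional constant on the tight set vanishes on every direction orthogonal to the normal. -/
theorem IsMinimalRepresentation.spansHyperplane {R : Finset (LinearConstraint V)} {X : Set V}
    (hR : IsMinimalRepresentation R X) (hX : (interior X).Nonempty) {A : LinearConstraint V}
    (hA : A ∈ R) : (tightSet X A).Nonempty ∧ SpansHyperplane (tightSet X A) A.normal := by
  classical
  obtain ⟨x, hx⟩ := hX
  have hn : ∀ B ∈ R, B.normal ≠ 0 := fun B hB =>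
    hR.normal_ne_zero ⟨x, interior_subset hx⟩ hB
  have hs : ∀ B ∈ R, B.offset < inner ℝ B.normal x := fun B hB =>
    lt_of_mem_interior (hn B hB) (hR.1 ▸ sat_subset_sat_singleton (Finset.mem_coe.2 hB)) hx
  obtain ⟨y, hy, hAy⟩ := hR.exists_violating hA
  have ha : 0 < inner ℝ A.normal x - A.offset := sub_pos.2 (hs A hA)
  have hb : 0 < A.offset - inner ℝ A.normal y := sub_pos.2 hAy
  set a := inner ℝ A.normal x - A.offset with hadef
  set b := A.offset - inner ℝ A.normal y with hbdef
  set z : V := (b / (a + b)) • x + (a / (a + b)) • y with hz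
  have hab : 0 < a + b := add_pos ha hb
  have hzA : inner ℝ A.normal z = A.offset := by
    rw [hz, inner_add_right, real_inner_smul_right, real_inner_smul_right]
    have h1 : inner ℝ A.normal x = a + A.offset := by rw [hadef]; ring
    have h2 : inner ℝ A.normal y = A.offset - b := by rw [hbdef]; ring
    rw [h1, h2]
    field_simp
    ring
  have hzs : ∀ B ∈ R.erase A, B.offset < inner ℝ B.normal z := by
    intro B hB
    obtain ⟨hBA, hB⟩ := Finset.mem_erase.1 hB
    rw [hz, inner_add_right, real_inner_smul_right, real_inner_smul_right]
    have h1 := mul_lt_mul_of_pos_left (hs B hB) (div_pos hb hab)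
    have h2 := mul_le_mul_of_nonneg_left (hy B hB hBA) (div_pos ha hab).le
    have h3 : b / (a + b) * B.offset + a / (a + b) * B.offset = B.offset := by
      field_simp
      ring
    linarith
  have key : ∀ w : V, inner ℝ A.normal w = A.offset →
      (∀ B ∈ R.erase A, B.offset < inner ℝ B.normal w) → w ∈ tightSet X A := by
    intro w hw hws
    refine ⟨?_, hw⟩
    rw [← hR.1]
    intro B hB
    by_cases hBA : B = A
    · rw [hBA, hw]
    · exact (hws B (Finset.mem_erase.2 ⟨hBA, hB⟩)).le
  refine ⟨⟨z, key z hzA hzs⟩, fun u k hu => ?_⟩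
  have hnn : inner ℝ A.normal A.normal ≠ 0 := (real_inner_self_pos.2 (hn A hA)).ne'
  set t : ℝ := inner ℝ A.normal u / inner ℝ A.normal A.normal with ht
  have hort : inner ℝ A.normal (u - t • A.normal) = 0 := by
    rw [inner_sub_right, real_inner_smul_right, ht]
    field_simp
    ring
  obtain ⟨ε, hε, hU⟩ := exists_pos_add_smul_mem ((isOpen_strict (R.erase A)).mem_nhds hzs)
    (u - t • A.normal)
  have h1 := hu _ (key z hzA hzs)
  have h2 := hu _ (key (z + ε • (u - t • A.normal))
    (by rw [inner_add_right, real_inner_smul_right, hort, hzA]; ring) hU)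
  rw [inner_add_right, real_inner_smul_right, h1] at h2
  have h3 : inner ℝ u (u - t • A.normal) = 0 := by
    have : ε * inner ℝ u (u - t • A.normal) = 0 := by linarith
    exact (mul_eq_zero.1 this).resolve_left hε.ne'
  have h4 : inner ℝ (u - t • A.normal) (u - t • A.normal) = 0 := by
    rw [inner_sub_left, h3, real_inner_smul_left, hort]; ring
  exact ⟨t, sub_eq_zero.1 (inner_self_eq_zero.1 h4)⟩

/-- A valid constraint that is tight on a set spanning its hyperplane is a multiple of an element
of any finite representation. -/
theorem exists_isPosMultiple {R : Finset (LinearConstraint V)} {X : Set V}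
    (hR : sat (R : Set (LinearConstraint V)) = X) (hX : (interior X).Nonempty)
    {A : LinearConstraint V} (hA : A.normal ≠ 0) (hXA : X ⊆ sat {A})
    (hne : (tightSet X A).Nonempty) (hs : SpansHyperplane (tightSet X A) A.normal) :
    ∃ B ∈ R, IsPosMultiple B A := by
  classical
  obtain ⟨x, hx, h⟩ := exists_mem_strict_or_tight
    (convex_tightSet (hR ▸ convex_sat (R : Set (LinearConstraint V))) A) hne R
    (fun y hy => hR ▸ hy.1)
  obtain ⟨y, hy⟩ := hX
  -- If every nontrivial constraint of `R` were strict at `x`, then `x` could be pushed across the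
  -- hyperplane of `A` without leaving `X`.
  have hBex : ∃ B ∈ R, B.normal ≠ 0 ∧ ∀ y ∈ tightSet X A, inner ℝ B.normal y = B.offset := by
    by_contra! hcon
    have hstr : ∀ B ∈ R.filter (fun B => B.normal ≠ 0), B.offset < inner ℝ B.normal x := by
      intro B hB
      obtain ⟨hB, hB0⟩ := Finset.mem_filter.1 hB
      refine (h B hB).resolve_right fun hall => ?_
      obtain ⟨y, hy, hyne⟩ := hcon B hB hB0
      exact hyne (hall y hy)
    obtain ⟨ε, hε, hU⟩ := exists_pos_add_smul_mem ((isOpen_strict _).mem_nhds hstr) (-A.normal)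
    have hmem : x + ε • (-A.normal) ∈ X := by
      rw [← hR]
      intro B hB
      by_cases hB0 : B.normal = 0
      · have := (hR ▸ hx.1 : x ∈ sat (R : Set (LinearConstraint V))) B hB
        rw [hB0, inner_zero_left] at this ⊢
        exact this
      · exact (hU B (Finset.mem_filter.2 ⟨hB, hB0⟩)).le
    have h1 := mem_sat_singleton.1 (hXA hmem)
    rw [inner_add_right, real_inner_smul_right, inner_neg_right, hx.2] at h1
    have : 0 < inner ℝ A.normal A.normal := real_inner_self_pos.2 hA
    nlinarith
  obtain ⟨B, hB, hB0, hBt⟩ := hBex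
  obtain ⟨t, ht⟩ := hs B.normal B.offset hBt
  have ho : B.offset = t * A.offset := by
    rw [← hBt x hx, ht, real_inner_smul_left, hx.2]
  refine ⟨B, hB, t, ?_, ht, ho⟩
  -- Both constraints are strict at an interior point, which forces `t > 0`.
  have h1 := lt_of_mem_interior hB0
    (hR ▸ sat_subset_sat_singleton (Finset.mem_coe.2 hB)) hy
  have h2 := lt_of_mem_interior hA hXA hy
  rw [ht, ho, real_inner_smul_left] at h1
  by_contra! ht0
  nlinarith

/-! ### Facets and vertices of convex sets -/

/-- The functionals constant on `F` form the orthogonal complement of its direction space. This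
complement contains the normal, and codimension one means that it is just the line through it. -/
theorem affDim_add_one_eq_iff [FiniteDimensional ℝ V] {F : Set V} {A : LinearConstraint V}
    (hA : A.normal ≠ 0) (hF : ∀ x ∈ F, inner ℝ A.normal x = A.offset) (hne : F.Nonempty) :
    affDim F + 1 = Module.finrank ℝ V ↔ SpansHyperplane F A.normal := by
  have horth : ∀ (u : V) (k : ℝ), (∀ x ∈ F, inner ℝ u x = k) → u ∈ (vectorSpan ℝ F)ᗮ := by
    intro u k hu
    rw [Submodule.mem_orthogonal']
    intro w hw
    rw [vectorSpan] at hw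
    induction hw using Submodule.span_induction with
    | mem x hx =>
      obtain ⟨a, ha, b, hb, rfl⟩ := hx
      simp [vsub_eq_sub, inner_sub_right, hu a ha, hu b hb]
    | zero => simp
    | add x y _ _ hx hy => rw [inner_add_right, hx, hy, add_zero]
    | smul a x _ hx => rw [real_inner_smul_right, hx, mul_zero]
  have hle : vectorSpan ℝ F ≤ (Submodule.span ℝ {A.normal})ᗮ := by
    rw [Submodule.le_orthogonal_iff_le_orthogonal, Submodule.span_singleton_le_iff_mem]
    exact horth _ _ hF
  have hdim : Module.finrank ℝ (Submodule.span ℝ {A.normal})ᗮ + 1 = Module.finrank ℝ V := by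
    have := Submodule.finrank_add_finrank_orthogonal (Submodule.span ℝ {A.normal})
    rw [finrank_span_singleton hA] at this
    omega
  constructor
  · intro h u k hu
    have heq := Submodule.eq_of_le_of_finrank_eq hle (by unfold affDim at h; omega)
    have hu' := horth u k hu
    rw [heq, Submodule.orthogonal_orthogonal] at hu'
    obtain ⟨t, ht⟩ := Submodule.mem_span_singleton.1 hu'
    exact ⟨t, ht.symm⟩
  · intro hs
    obtain ⟨x, hx⟩ := hne
    have hge : (vectorSpan ℝ F)ᗮ ≤ Submodule.span ℝ {A.normal} := by
      intro u hu
      obtain ⟨t, ht⟩ := hs u (inner ℝ u x) fun y hy => by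
        have := (Submodule.mem_orthogonal' _ _).1 hu (y -ᵥ x) (vsub_mem_vectorSpan ℝ hy hx)
        rw [vsub_eq_sub, inner_sub_right] at this
        linarith
      exact Submodule.mem_span_singleton.2 ⟨t, ht.symm⟩
    have heq : vectorSpan ℝ F = (Submodule.span ℝ {A.normal})ᗮ := by
      refine le_antisymm hle ?_
      have := Submodule.orthogonal_le hge
      rwa [Submodule.orthogonal_orthogonal] at this
    rw [affDim, heq, hdim]

/-- Slacks are nonnegative on `C`, so a tight set always has the face property; only its dimension
is in question. -/
theorem isFacet_tightSet_iff [FiniteDimensional ℝ V] {C : Set V} (hC : Convex ℝ C)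
    {A : LinearConstraint V} (hA : A.normal ≠ 0) (hCA : C ⊆ sat {A}) :
    IsFacet (tightSet C A) C ↔
      (tightSet C A).Nonempty ∧ SpansHyperplane (tightSet C A) A.normal := by
  constructor
  · rintro ⟨K, hK, hne, -, -, hdim, -⟩
    exact ⟨hne, (affDim_add_one_eq_iff hA (fun x hx => hx.2) hne).1 (by rw [hdim, hK])⟩
  · rintro ⟨hne, hs⟩
    refine ⟨_, (affDim_add_one_eq_iff hA (fun x hx => hx.2) hne).2 hs, hne,
      convex_tightSet hC A, fun x hx => hx.1, rfl, ?_⟩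
    rintro φ hφ x hx y hy μ h0 h1 rfl
    have h := hφ.2
    have hx' := mem_sat_singleton.1 (hCA hx)
    have hy' := mem_sat_singleton.1 (hCA hy)
    rw [inner_add_right, real_inner_smul_right, real_inner_smul_right] at h
    have h1' : 0 < 1 - μ := sub_pos.2 h1
    have e1 := mul_nonneg h0.le (sub_nonneg.2 hx')
    have e2 := mul_nonneg h1'.le (sub_nonneg.2 hy')
    have e3 : μ * (inner ℝ A.normal x - A.offset) = 0 := by nlinarith
    have e4 : (1 - μ) * (inner ℝ A.normal y - A.offset) = 0 := by nlinarith
    exact ⟨⟨hx, sub_eq_zero.1 ((mul_eq_zero.1 e3).resolve_left h0.ne')⟩,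
      ⟨hy, sub_eq_zero.1 ((mul_eq_zero.1 e4).resolve_left h1'.ne')⟩⟩

/-- For convex `F`, the positive multiples of differences are already closed under addition and
scaling. -/
theorem exists_smul_sub_of_mem_vectorSpan {F : Set V} (hF : Convex ℝ F)
    (hne : F.Nonempty) {w : V} (hw : w ∈ vectorSpan ℝ F) :
    ∃ t : ℝ, 0 < t ∧ ∃ a ∈ F, ∃ b ∈ F, w = t • (a - b) := by
  rw [vectorSpan] at hw
  obtain ⟨x, hx⟩ := hne
  induction hw using Submodule.span_induction with
  | mem w hw =>
    obtain ⟨a, ha, b, hb, rfl⟩ := hw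
    exact ⟨1, one_pos, a, ha, b, hb, by simp⟩
  | zero => exact ⟨1, one_pos, x, hx, x, hx, by simp⟩
  | add v w _ _ hv hw =>
    obtain ⟨t, ht, a, ha, b, hb, rfl⟩ := hv
    obtain ⟨s, hs, a', ha', b', hb', rfl⟩ := hw
    have hts : 0 < t + s := add_pos ht hs
    have h1 : t / (t + s) + s / (t + s) = 1 := by field_simp
    refine ⟨t + s, hts, _, hF ha ha' (div_pos ht hts).le (div_pos hs hts).le h1, _,
      hF hb hb' (div_pos ht hts).le (div_pos hs hts).le h1, ?_⟩
    have e1 : (t + s) * (t / (t + s)) = t := by field_simp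
    have e2 : (t + s) * (s / (t + s)) = s := by field_simp
    simp only [smul_sub, smul_add, smul_smul, e1, e2]
    abel
  | smul c w _ hw =>
    obtain ⟨t, ht, a, ha, b, hb, rfl⟩ := hw
    rcases lt_trichotomy c 0 with hc | rfl | hc
    · refine ⟨-c * t, mul_pos (neg_pos.2 hc) ht, b, hb, a, ha, ?_⟩
      rw [smul_smul, ← neg_sub b a, smul_neg, neg_mul, neg_smul]
    · exact ⟨1, one_pos, x, hx, x, hx, by simp⟩
    · exact ⟨c * t, mul_pos hc ht, a, ha, b, hb, by rw [smul_smul]⟩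

/-- Facets of full-dimensional convex sets are exposed. -/
theorem IsFacet.exists_eq_tightSet [FiniteDimensional ℝ V] {C F : Set V} (hC : Convex ℝ C)
    (hint : (interior C).Nonempty) (hF : IsFacet F C) :
    ∃ A : LinearConstraint V, A.normal ≠ 0 ∧ C ⊆ sat {A} ∧ F = tightSet C A := by
  obtain ⟨K, hK, hne, hFc, hFC, hdim, hface⟩ := hF
  have hdisj : Disjoint (interior C) F := by
    rw [Set.disjoint_left]
    intro x hx hxF
    have hCF : C ⊆ F := by
      intro y hy
      obtain ⟨ε, hε, hz⟩ := exists_pos_add_smul_mem (mem_interior_iff_mem_nhds.1 hx) (x - y)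
      refine (hface x hxF y hy _ hz (ε / (1 + ε)) (by positivity)
        ((div_lt_one (by positivity)).2 (by linarith)) ?_).1
      have e1 : 1 - ε / (1 + ε) = 1 / (1 + ε) := by field_simp; ring
      have e2 : ε / (1 + ε) = 1 / (1 + ε) * ε := by ring
      rw [e1, e2, ← smul_smul, ← smul_add]
      have e3 : ε • y + (x + ε • (x - y)) = (1 + ε) • x := by
        rw [smul_sub, add_smul, one_smul]; abel
      rw [e3, smul_smul, one_div_mul_cancel (by positivity), one_smul]
    have hspan : vectorSpan ℝ F = ⊤ := by
      rw [hFC.antisymm hCF, ← AffineSubspace.affineSpan_eq_top_iff_vectorSpan_eq_top_of_nonempty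
        ℝ V V (hint.mono interior_subset)]
      exact hC.interior_nonempty_iff_affineSpan_eq_top.1 hint
    rw [affDim, hspan, finrank_top] at hdim
    omega
  obtain ⟨f, u, hfC, hfF⟩ := geometric_hahn_banach_open hC.interior isOpen_interior hFc hdisj
  have hfC' : ∀ x ∈ C, f x ≤ u := by
    have hcl : closure (interior C) ⊆ {x | f x ≤ u} :=
      closure_minimal (fun x hx => (hfC x hx).le) (isClosed_le f.continuous continuous_const)
    intro x hx
    exact hcl (by rw [hC.closure_interior_eq_closure_of_nonempty_interior hint]
                  exact subset_closure hx)
  set n : V := (InnerProductSpace.toDual ℝ V).symm f with hn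
  have hnf : ∀ x, inner ℝ n x = f x := fun x => by
    rw [hn, InnerProductSpace.toDual_symm_apply]
  let A : LinearConstraint V := ⟨-n, -u⟩
  have hA0 : A.normal ≠ 0 := by
    intro h
    have hn0 : n = 0 := neg_eq_zero.1 h
    obtain ⟨x, hx⟩ := hint
    obtain ⟨y, hy⟩ := hne
    have h1 := hfC x hx
    have h2 := hfF y hy
    rw [← hnf, hn0, inner_zero_left] at h1 h2
    linarith
  have hCA : C ⊆ sat {A} := fun x hx => mem_sat_singleton.2 (by
    change -u ≤ inner ℝ (-n) x
    rw [inner_neg_left, hnf]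
    linarith [hfC' x hx])
  have hFA : ∀ x ∈ F, inner ℝ A.normal x = A.offset := fun x hx => by
    change inner ℝ (-n) x = -u
    rw [inner_neg_left, hnf, le_antisymm (hfC' x (hFC hx)) (hfF x hx)]
  refine ⟨A, hA0, hCA, Set.Subset.antisymm (fun x hx => ⟨hFC hx, hFA x hx⟩) ?_⟩
  rintro y ⟨hyC, hyA⟩
  obtain ⟨x, hx⟩ := hne
  have hs := (affDim_add_one_eq_iff hA0 hFA ⟨x, hx⟩).1 (by rw [hdim, hK])
  have hmem : y - x ∈ vectorSpan ℝ F := by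
    rw [← Submodule.orthogonal_orthogonal (vectorSpan ℝ F), Submodule.mem_orthogonal]
    intro w hw
    obtain ⟨t, rfl⟩ := hs w (inner ℝ w x) fun z hz => by
      have := (Submodule.mem_orthogonal' _ _).1 hw (z -ᵥ x) (vsub_mem_vectorSpan ℝ hz hx)
      rw [vsub_eq_sub, inner_sub_right] at this
      linarith
    rw [real_inner_smul_left, inner_sub_right, hyA, hFA x hx, sub_self, mul_zero]
  obtain ⟨t, ht, a, ha, b, hb, hab⟩ := exists_smul_sub_of_mem_vectorSpan hFc ⟨x, hx⟩ hmem
  -- From y - x = t(a - b), the point (x + ta)/(1 + t) of `F` equals (y + tb)/(1 + t), so the face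
  -- property puts `y` in `F`.
  have hw : 1 / (1 + t) + t / (1 + t) = 1 := by field_simp
  refine (hface _ (hFc hx ha (by positivity) (by positivity) hw) y hyC b (hFC hb) (1 / (1 + t))
    (by positivity) ((div_lt_one (by positivity)).2 (by linarith)) ?_).1
  have e1 : 1 - 1 / (1 + t) = t / (1 + t) := by linarith
  have e2 : t / (1 + t) = 1 / (1 + t) * t := by ring
  rw [e1, e2, ← smul_smul, ← smul_smul, ← smul_add, ← smul_add]
  congr 1
  rw [eq_add_of_sub_eq hab, smul_sub]
  abel

/-- A tight set that is a facet of `C` comes from a constraint valid on `C`, if the constraint is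
valid on a subset with nonempty interior. -/
theorem IsFacet.subset_sat {C H : Set V} {A : LinearConstraint V} (hA : A.normal ≠ 0)
    (hHC : H ⊆ C) (hHA : H ⊆ sat {A}) (hint : (interior H).Nonempty)
    (hC : Convex ℝ C) (hF : IsFacet (tightSet C A) C) : C ⊆ sat {A} := by
  obtain ⟨K, -, -, -, -, -, hface⟩ := hF
  obtain ⟨x, hx⟩ := hint
  intro y hy
  rw [mem_sat_singleton]
  by_contra! hlt
  have hxC := hHC (interior_subset hx)
  have hxA := lt_of_mem_interior hA hHA hx
  set a := inner ℝ A.normal x - A.offset with ha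
  set b := A.offset - inner ℝ A.normal y with hb
  have ha0 : 0 < a := sub_pos.2 hxA
  have hb0 : 0 < b := sub_pos.2 hlt
  have hw : a / (a + b) + b / (a + b) = 1 := by field_simp
  have e1 : 1 - a / (a + b) = b / (a + b) := by linarith
  -- The weights are those at which the segment from the violating `y` to the strict `x` meets the
  -- hyperplane; the face property would then make `y` tight.
  have := (hface ((a / (a + b)) • y + (1 - a / (a + b)) • x) ⟨?_, ?_⟩ y hy x hxC (a / (a + b))
    (by positivity) ((div_lt_one (by positivity)).2 (by linarith)) rfl).1.2
  · exact hlt.ne this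
  · rw [e1]
    exact hC hy hxC (by positivity) (by positivity) hw
  · rw [e1, inner_add_right, real_inner_smul_right, real_inner_smul_right]
    have h1 : inner ℝ A.normal x = a + A.offset := by rw [ha]; ring
    have h2 : inner ℝ A.normal y = A.offset - b := by rw [hb]; ring
    rw [h1, h2]
    field_simp
    ring

theorem isVertex_iff {v : V} {C : Set V} :
    IsVertex v C ↔ v ∈ C ∧ ∀ x ∈ C, ∀ y ∈ C, ∀ μ : ℝ, 0 < μ → μ < 1 →
      v = μ • x + (1 - μ) • y → x = v ∧ y = v := by
  constructor
  · rintro ⟨-, -, hv, -, h⟩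
    exact ⟨hv rfl, fun x hx y hy μ h0 h1 he => h v rfl x hx y hy μ h0 h1 he⟩
  · rintro ⟨hv, h⟩
    refine ⟨Set.singleton_nonempty v, convex_singleton v, Set.singleton_subset_iff.2 hv,
      by simp [affDim], ?_⟩
    rintro φ rfl x hx y hy μ h0 h1 he
    exact h x hx y hy μ h0 h1 he

/-! ### Affine Farkas lemma -/

/-- The affine Farkas lemma for a system with a strict solution. -/
theorem exists_nonneg_combination [FiniteDimensional ℝ V] {R : Finset (LinearConstraint V)}
    {b₀ : V} (hb : ∀ A ∈ R, A.offset < inner ℝ A.normal b₀) {B : LinearConstraint V}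
    (hB : B.offset < inner ℝ B.normal b₀)
    (hRB : sat (R : Set (LinearConstraint V)) ⊆ sat {B}) :
    ∃ w : LinearConstraint V → ℝ, (∀ A ∈ R, 0 ≤ w A) ∧ B.normal = ∑ A ∈ R, w A • A.normal ∧
      B.offset ≤ ∑ A ∈ R, w A * A.offset := by
  classical
  -- With `b₀` as origin and normals divided by their slack, each constraint of `R` reads g·y ≥ -1.
  -- Implication then becomes membership in the convex hull of 0 and the `g A`, by polar duality.
  let d : LinearConstraint V → ℝ := fun A => inner ℝ A.normal b₀ - A.offset
  let g : LinearConstraint V → V := fun A => (d A)⁻¹ • A.normal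
  have hd : ∀ A ∈ R, 0 < d A := fun A hA => sub_pos.2 (hb A hA)
  have hdB : 0 < d B := sub_pos.2 hB
  let S : Set V := insert 0 (g '' (R : Set (LinearConstraint V)))
  have hSfin : S.Finite := (R.finite_toSet.image g).insert 0
  have hmem : g B ∈ convexHull ℝ S := by
    by_contra hnot
    obtain ⟨f, u, hfu, hfS⟩ := geometric_hahn_banach_point_closed (convex_convexHull ℝ S)
      (hSfin.isClosed_convexHull ℝ) hnot
    set x : V := (InnerProductSpace.toDual ℝ V).symm f with hx
    have hxf : ∀ y, inner ℝ y x = f y := fun y => by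
      rw [real_inner_comm, hx, InnerProductSpace.toDual_symm_apply]
    have hu : u < 0 := by
      have := hfS 0 (subset_convexHull ℝ S (Set.mem_insert _ _))
      simpa using this
    have hlt : 0 < -u := neg_pos.2 hu
    have hu0 : u ≠ 0 := hu.ne
    -- The separating direction, scaled so that its threshold is -1, leads to a point satisfying `R`
    -- and violating `B`.
    have hval : ∀ A, inner ℝ A.normal (b₀ + (-u)⁻¹ • x) - A.offset =
        d A + (-u)⁻¹ * f A.normal := by
      intro A
      rw [inner_add_right, real_inner_smul_right, hxf]
      ring
    have hfg : ∀ A, f (g A) = (d A)⁻¹ * f A.normal := fun A => by simp [g]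
    have hsat : b₀ + (-u)⁻¹ • x ∈ sat (R : Set (LinearConstraint V)) := by
      intro A hA
      rw [← sub_nonneg, hval]
      have h1 := hfS (g A) (subset_convexHull ℝ S
        (Set.mem_insert_of_mem _ (Set.mem_image_of_mem g hA)))
      rw [hfg, inv_mul_eq_div, lt_div_iff₀ (hd A hA)] at h1
      have h2 := mul_lt_mul_of_pos_left h1 (inv_pos.2 hlt)
      have h3 : (-u)⁻¹ * (u * d A) = - d A := by field_simp
      linarith
    have h := mem_sat_singleton.1 (hRB hsat)
    rw [← sub_nonneg, hval] at h
    rw [hfg, inv_mul_eq_div, div_lt_iff₀ hdB] at hfu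
    have h2 := mul_lt_mul_of_pos_left hfu (inv_pos.2 hlt)
    have h3 : (-u)⁻¹ * (u * d B) = - d B := by field_simp
    linarith
  have hsub : convexHull ℝ S ⊆ {y | ∃ w : LinearConstraint V → ℝ, (∀ A ∈ R, 0 ≤ w A) ∧
      ∑ A ∈ R, w A ≤ 1 ∧ y = ∑ A ∈ R, w A • g A} := by
    refine convexHull_min ?_ ?_
    · rintro y (rfl | ⟨A, hA, rfl⟩)
      · exact ⟨0, by simp, by simp, by simp⟩
      · refine ⟨Pi.single A 1, fun C _ => ?_, ?_, ?_⟩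
        · rw [Pi.single_apply]; split_ifs <;> norm_num
        · rw [Finset.sum_pi_single', if_pos (Finset.mem_coe.1 hA)]
        · simp [Pi.single_apply, ite_smul, Finset.mem_coe.1 hA]
    · rintro y ⟨w, hw, hw1, rfl⟩ y' ⟨w', hw', hw1', rfl⟩ a b ha hb hab
      refine ⟨fun A => a * w A + b * w' A, fun A hA => add_nonneg (mul_nonneg ha (hw A hA))
        (mul_nonneg hb (hw' A hA)), ?_, ?_⟩
      · rw [Finset.sum_add_distrib, ← Finset.mul_sum, ← Finset.mul_sum]
        nlinarith
      · simp only [add_smul, Finset.sum_add_distrib, Finset.smul_sum, smul_smul]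
  obtain ⟨w, hw, hw1, hg⟩ := hsub hmem
  have hnormal : B.normal = ∑ A ∈ R, (d B * w A * (d A)⁻¹) • A.normal := by
    have : B.normal = d B • g B := by simp [g, smul_smul, mul_inv_cancel₀ hdB.ne']
    rw [this, hg, Finset.smul_sum]
    simp only [g, smul_smul, mul_assoc]
  refine ⟨fun A => d B * w A * (d A)⁻¹, fun A hA => mul_nonneg (mul_nonneg hdB.le (hw A hA))
    (inv_pos.2 (hd A hA)).le, hnormal, ?_⟩
  have h1 : inner ℝ B.normal b₀ = ∑ A ∈ R, d B * w A * (d A)⁻¹ * inner ℝ A.normal b₀ := by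
    rw [hnormal, sum_inner]
    simp only [real_inner_smul_left]
  -- The offset bound follows because the hull weights sum to at most 1, the rest being carried by
  -- 0.
  have h2 : ∑ A ∈ R, d B * w A * (d A)⁻¹ * A.offset =
      inner ℝ B.normal b₀ - d B * ∑ A ∈ R, w A := by
    rw [h1, Finset.mul_sum, ← Finset.sum_sub_distrib]
    refine Finset.sum_congr rfl fun A hA => ?_
    have h3 : A.offset = inner ℝ A.normal b₀ - d A := by simp [d]
    have h4 : d A ≠ 0 := (hd A hA).ne'
    rw [h3]
    field_simp
  rw [h2]
  have h3 : B.offset = inner ℝ B.normal b₀ - d B := by simp [d]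
  nlinarith

/-! ### The polytope H_s and facets of the cone -/

variable {ι : Type*} {Ω : ι → LinearConstraint V}

theorem hullH_subset {p : ℕ} {s : ℝ} {T : Set V} (hT : Convex ℝ T)
    (hP : ∀ i, (Ω i).offset = s → (Ω i).normal ∈ T)
    (hZ : ∀ i j, (Ω i).offset = s → (Ω j).offset = 0 →
      (Ω i).normal + ((p : ℝ) - 1) • (Ω j).normal ∈ T)
    (hN : ∀ i j, (Ω i).offset = s → (Ω j).offset = -s →
      (p : ℝ) • (Ω i).normal + ((p : ℝ) - 1) • (Ω j).normal ∈ T) : hullH Ω p s ⊆ T := by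
  refine convexHull_min ?_ hT
  rintro x ((⟨i, hi, rfl⟩ | ⟨i, j, hi, hj, rfl⟩) | ⟨i, j, hi, hj, rfl⟩)
  · exact hP i hi
  · exact hZ i j hi hj
  · exact hN i j hi hj

theorem mem_hullH_P {p : ℕ} {s : ℝ} {i : ι} (hi : (Ω i).offset = s) :
    (Ω i).normal ∈ hullH Ω p s :=
  subset_convexHull ℝ _ (Or.inl (Or.inl ⟨i, hi, rfl⟩))

theorem mem_hullH_Z {p : ℕ} {s : ℝ} {i j : ι} (hi : (Ω i).offset = s) (hj : (Ω j).offset = 0) :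
    (Ω i).normal + ((p : ℝ) - 1) • (Ω j).normal ∈ hullH Ω p s :=
  subset_convexHull ℝ _ (Or.inl (Or.inr ⟨i, j, hi, hj, rfl⟩))

theorem mem_hullH_N {p : ℕ} {s : ℝ} {i j : ι} (hi : (Ω i).offset = s) (hj : (Ω j).offset = -s) :
    (p : ℝ) • (Ω i).normal + ((p : ℝ) - 1) • (Ω j).normal ∈ hullH Ω p s :=
  subset_convexHull ℝ _ (Or.inr ⟨i, j, hi, hj, rfl⟩)

theorem convex_hullH {p : ℕ} {s : ℝ} : Convex ℝ (hullH Ω p s) := convex_convexHull ℝ _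

theorem offset_cases {c s : ℝ} (hc : c = 1 ∨ c = 0 ∨ c = -1) (hs : s * s = 1) :
    c = s ∨ c = 0 ∨ c = -s := by
  rcases mul_self_eq_one_iff.1 hs with rfl | rfl
  · exact hc
  · rw [neg_neg]
    tauto

/-- The functional `(x, c) ↦ n · x - q c` is nonnegative on all pairs `(αᵢ, cᵢ)`, it vanishes on
some pair with `cᵢ = s`, and the pairs on which it vanishes determine `n` up to scale. -/
def IsConeFacet (Ω : ι → LinearConstraint V) (s q : ℝ) (n : V) : Prop :=
  (∀ i, q * (Ω i).offset ≤ inner ℝ n (Ω i).normal) ∧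
    (∃ i, (Ω i).offset = s ∧ inner ℝ n (Ω i).normal = q * (Ω i).offset) ∧
    ∀ (u : V) (k : ℝ), (∀ i, inner ℝ n (Ω i).normal = q * (Ω i).offset →
      inner ℝ u (Ω i).normal = k * (Ω i).offset) → ∃ t : ℝ, u = t • n

/-- Subtracting the equality at the tight αᵢ from the inequalities at αᵢ + (p - 1)αⱼ and pαᵢ + (p -
1)αⱼ leaves the inequality for the pair of index j, as p > 1. A generator of H_s is tight only if
its constituent pairs are, so a functional prescribed on tight pairs is constant on the tight part
of H_s. -/
theorem isConeFacet_of_spansHyperplane_hullH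
    (hc : ∀ i, (Ω i).offset = 1 ∨ (Ω i).offset = 0 ∨ (Ω i).offset = -1)
    {p : ℕ} (hp : 1 < p) {s : ℝ} (hs : s * s = 1) {A : LinearConstraint V}
    (hHA : hullH Ω p s ⊆ sat {A}) (hsp : SpansHyperplane (tightSet (hullH Ω p s) A) A.normal)
    (hM : ∃ i, (Ω i).offset = s ∧ inner ℝ A.normal (Ω i).normal = A.offset) :
    IsConeFacet Ω s (s * A.offset) A.normal := by
  have hp1 : (1 : ℝ) < p := by exact_mod_cast hp
  have hp2 : 0 < (p : ℝ) - 1 := sub_pos.2 hp1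
  have hsr : s * A.offset * s = A.offset := by linear_combination A.offset * hs
  obtain ⟨i₀, hi₀, hi₀t⟩ := hM
  have hP : ∀ i, (Ω i).offset = s → A.offset ≤ inner ℝ A.normal (Ω i).normal := fun i hi =>
    mem_sat_singleton.1 (hHA (mem_hullH_P hi))
  have hZ : ∀ i, (Ω i).offset = 0 → 0 ≤ inner ℝ A.normal (Ω i).normal := fun i hi => by
    have := mem_sat_singleton.1 (hHA (mem_hullH_Z hi₀ hi))
    rw [inner_add_right, real_inner_smul_right, hi₀t] at this
    exact nonneg_of_mul_nonneg_right (by linarith) hp2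
  have hN : ∀ i, (Ω i).offset = -s → -A.offset ≤ inner ℝ A.normal (Ω i).normal := fun i hi => by
    have := mem_sat_singleton.1 (hHA (mem_hullH_N hi₀ hi))
    rw [inner_add_right, real_inner_smul_right, real_inner_smul_right, hi₀t] at this
    have h : 0 ≤ A.offset + inner ℝ A.normal (Ω i).normal :=
      nonneg_of_mul_nonneg_right (by linarith) hp2
    linarith
  refine ⟨fun i => ?_, ⟨i₀, hi₀, by rw [hi₀, hsr, hi₀t]⟩, fun u k hu => ?_⟩
  · rcases offset_cases (hc i) hs with hi | hi | hi
    · rw [hi, hsr]; exact hP i hi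
    · rw [hi, mul_zero]; exact hZ i hi
    · rw [hi, mul_neg, hsr]; exact hN i hi
  · have huP : ∀ i, (Ω i).offset = s → inner ℝ A.normal (Ω i).normal = A.offset →
        inner ℝ u (Ω i).normal = k * s := fun i hi h => by
      rw [hu i (by rw [hi, hsr, h]), hi]
    have huZ : ∀ i, (Ω i).offset = 0 → inner ℝ A.normal (Ω i).normal = 0 →
        inner ℝ u (Ω i).normal = 0 := fun i hi h => by
      rw [hu i (by rw [hi, mul_zero, h]), hi, mul_zero]
    have huN : ∀ i, (Ω i).offset = -s → inner ℝ A.normal (Ω i).normal = -A.offset →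
        inner ℝ u (Ω i).normal = -(k * s) := fun i hi h => by
      rw [hu i (by rw [hi, mul_neg, hsr, h]), hi, mul_neg]
    -- This set is convex: a tight convex combination has tight components wherever the weight is
    -- nonzero. It thus suffices to check the generators.
    have hsub : hullH Ω p s ⊆ {x | A.offset ≤ inner ℝ A.normal x ∧
        (inner ℝ A.normal x = A.offset → inner ℝ u x = k * s)} := by
      refine hullH_subset ?_ (fun i hi => ⟨hP i hi, huP i hi⟩) (fun i j hi hj => ?_)
        fun i j hi hj => ?_
      · rintro x ⟨hx1, hx2⟩ y ⟨hy1, hy2⟩ a b ha hb hab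
        have e1 := mul_nonneg ha (sub_nonneg.2 hx1)
        have e2 := mul_nonneg hb (sub_nonneg.2 hy1)
        have e3 : a * A.offset + b * A.offset = A.offset := by rw [← add_mul, hab, one_mul]
        have e4 : a * (k * s) + b * (k * s) = k * s := by rw [← add_mul, hab, one_mul]
        refine ⟨?_, fun h => ?_⟩
        · rw [inner_add_right, real_inner_smul_right, real_inner_smul_right]
          linarith
        · rw [inner_add_right, real_inner_smul_right, real_inner_smul_right] at h ⊢
          have f1 : a * (inner ℝ A.normal x - A.offset) = 0 := by linarith
          have f2 : b * (inner ℝ A.normal y - A.offset) = 0 := by linarith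
          have g1 : a * inner ℝ u x = a * (k * s) := by
            rcases mul_eq_zero.1 f1 with h | h
            · rw [h, zero_mul, zero_mul]
            · rw [hx2 (sub_eq_zero.1 h)]
          have g2 : b * inner ℝ u y = b * (k * s) := by
            rcases mul_eq_zero.1 f2 with h | h
            · rw [h, zero_mul, zero_mul]
            · rw [hy2 (sub_eq_zero.1 h)]
          rw [g1, g2, e4]
      · have e1 := hP i hi
        have e2 := mul_nonneg hp2.le (hZ j hj)
        refine ⟨?_, fun h => ?_⟩
        · rw [inner_add_right, real_inner_smul_right]
          linarith
        · rw [inner_add_right, real_inner_smul_right] at h ⊢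
          have f1 : inner ℝ A.normal (Ω i).normal = A.offset := by linarith
          have f2 : ((p : ℝ) - 1) * inner ℝ A.normal (Ω j).normal = 0 := by linarith
          rw [huP i hi f1, huZ j hj ((mul_eq_zero.1 f2).resolve_left hp2.ne')]
          ring
      · have e1 := mul_nonneg (zero_lt_one.trans hp1).le (sub_nonneg.2 (hP i hi))
        have e2 := mul_nonneg hp2.le (sub_nonneg.2 (hN j hj))
        refine ⟨?_, fun h => ?_⟩
        · rw [inner_add_right, real_inner_smul_right, real_inner_smul_right]
          linarith
        · rw [inner_add_right, real_inner_smul_right, real_inner_smul_right] at h ⊢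
          have f1 : (p : ℝ) * (inner ℝ A.normal (Ω i).normal - A.offset) = 0 := by linarith
          have f2 : ((p : ℝ) - 1) * (inner ℝ A.normal (Ω j).normal - -A.offset) = 0 := by linarith
          rw [huP i hi (sub_eq_zero.1 ((mul_eq_zero.1 f1).resolve_left (by positivity))),
            huN j hj (sub_eq_zero.1 ((mul_eq_zero.1 f2).resolve_left hp2.ne'))]
          ring
    exact hsp u (k * s) fun x hx => (hsub hx.1).2 hx.2

/-- Combined with a fixed tight αᵢ of height s, each tight pair yields a tight generator of H_s, so
the value of `u` on the pair can be recovered. -/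
theorem IsConeFacet.spansHyperplane_hullH
    (hc : ∀ i, (Ω i).offset = 1 ∨ (Ω i).offset = 0 ∨ (Ω i).offset = -1)
    {p : ℕ} (hp : 1 < p) {s : ℝ} (hs : s * s = 1) {A : LinearConstraint V}
    (hA : IsConeFacet Ω s (s * A.offset) A.normal) :
    (tightSet (hullH Ω p s) A).Nonempty ∧
      SpansHyperplane (tightSet (hullH Ω p s) A) A.normal := by
  have hp1 : (1 : ℝ) < p := by exact_mod_cast hp
  have hp2 : 0 < (p : ℝ) - 1 := sub_pos.2 hp1
  have hsr : s * A.offset * s = A.offset := by linear_combination A.offset * hs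
  obtain ⟨-, ⟨i₀, hi₀, hi₀t⟩, hdet⟩ := hA
  rw [hi₀, hsr] at hi₀t
  refine ⟨⟨_, mem_hullH_P hi₀, hi₀t⟩, fun u k hu => hdet u (k * s) fun i hi => ?_⟩
  have hu₀ : inner ℝ u (Ω i₀).normal = k := hu _ ⟨mem_hullH_P hi₀, hi₀t⟩
  rcases offset_cases (hc i) hs with h | h | h
  · rw [h, hsr] at hi
    rw [hu _ ⟨mem_hullH_P h, hi⟩, h]
    linear_combination -k * hs
  · rw [h, mul_zero] at hi
    have := hu _ ⟨mem_hullH_Z hi₀ h, by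
      rw [inner_add_right, real_inner_smul_right, hi₀t, hi]; ring⟩
    rw [inner_add_right, real_inner_smul_right, hu₀] at this
    rw [h, mul_zero]
    exact (mul_eq_zero.1 (by linarith : ((p : ℝ) - 1) * inner ℝ u (Ω i).normal = 0)).resolve_left
      hp2.ne'
  · rw [h, mul_neg, hsr] at hi
    have := hu _ ⟨mem_hullH_N hi₀ h, by
      rw [inner_add_right, real_inner_smul_right, real_inner_smul_right, hi₀t, hi]; ring⟩
    rw [inner_add_right, real_inner_smul_right, real_inner_smul_right, hu₀] at this
    have h0 : ((p : ℝ) - 1) * (k + inner ℝ u (Ω i).normal) = 0 := by linarith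
    have h1 := (mul_eq_zero.1 h0).resolve_left hp2.ne'
    rw [h]
    linear_combination h1 + k * hs

/-! ### Interior of H_s, the selection M_s and vertices of sat(Ω) -/

theorem isVertex_sat_of_forall_tight {v : V} (hv : v ∈ sat (Set.range Ω))
    (h : ∀ u : V, (∀ i, inner ℝ (Ω i).normal v = (Ω i).offset → inner ℝ (Ω i).normal u = 0) →
      u = 0) : IsVertex v (sat (Set.range Ω)) := by
  refine isVertex_iff.2 ⟨hv, fun x hx y hy μ h0 h1 he => ?_⟩
  have h1' : 0 < 1 - μ := sub_pos.2 h1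
  have key : ∀ i, inner ℝ (Ω i).normal v = (Ω i).offset →
      inner ℝ (Ω i).normal x = (Ω i).offset ∧ inner ℝ (Ω i).normal y = (Ω i).offset := by
    intro i hi
    have hxi := mul_nonneg h0.le (sub_nonneg.2 (hx _ ⟨i, rfl⟩))
    have hyi := mul_nonneg h1'.le (sub_nonneg.2 (hy _ ⟨i, rfl⟩))
    have e := hi
    rw [he, inner_add_right, real_inner_smul_right, real_inner_smul_right] at e
    have f1 : μ * (inner ℝ (Ω i).normal x - (Ω i).offset) = 0 := by linarith
    have f2 : (1 - μ) * (inner ℝ (Ω i).normal y - (Ω i).offset) = 0 := by linarith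
    exact ⟨sub_eq_zero.1 ((mul_eq_zero.1 f1).resolve_left h0.ne'),
      sub_eq_zero.1 ((mul_eq_zero.1 f2).resolve_left h1'.ne')⟩
  exact ⟨sub_eq_zero.1 (h _ fun i hi => by rw [inner_sub_right, (key i hi).1, hi, sub_self]),
    sub_eq_zero.1 (h _ fun i hi => by rw [inner_sub_right, (key i hi).2, hi, sub_self])⟩

/-- A constraint of `L` tight on all of H_s supports the points of P_s, hence lies in M_s, and an
interior point of sat(℧_s) satisfies it strictly. Moving slightly towards that point from one where
the other constraints are strict makes all of them strict. -/
theorem interior_hullH_nonempty [FiniteDimensional ℝ V] {p : ℕ} {s : ℝ}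
    {L : Finset (LinearConstraint V)} (hL : IsMinimalRepresentation L (hullH Ω p s))
    (hM : Nondegenerate (sat (setM Ω s L))) (hs : ∃ i, (Ω i).offset = s) :
    (interior (hullH Ω p s)).Nonempty := by
  classical
  obtain ⟨i, hi⟩ := hs
  have hne : (hullH Ω p s).Nonempty := ⟨_, mem_hullH_P hi⟩
  obtain ⟨y, hy⟩ := hM.interior_nonempty (convex_sat _)
  obtain ⟨x, hx, hxL⟩ := exists_mem_strict_or_tight convex_hullH hne L hL.1.ge
  have hstr : ∀ A ∈ L.filter (fun A => A.offset < inner ℝ A.normal x),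
      A.offset < inner ℝ A.normal x := fun A hA => (Finset.mem_filter.1 hA).2
  obtain ⟨ε, hε, hU⟩ := exists_pos_add_smul_mem ((isOpen_strict _).mem_nhds hstr) (y - x)
  refine ⟨x + ε • (y - x), ?_⟩
  rw [← hL.1]
  refine mem_interior_sat_of_strict fun A hA => ?_
  rcases hxL A hA with h | h
  · exact hU A (Finset.mem_filter.2 ⟨hA, h⟩)
  · have hA0 := hL.normal_ne_zero hne hA
    have hAM : A ∈ setM Ω s L := ⟨hA, _, ⟨i, hi, rfl⟩, hA0, h _ (mem_hullH_P hi)⟩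
    have h1 := lt_of_mem_interior hA0 (sat_subset_sat_singleton hAM) hy
    rw [inner_add_right, real_inner_smul_right, inner_sub_right, h x hx]
    nlinarith [mul_pos hε (sub_pos.2 h1)]

theorem exists_not_mem_sat_singleton {A : LinearConstraint V} (hA : A.normal ≠ 0) :
    ∃ b, b ∉ sat {A} := by
  refine ⟨((A.offset - 1) / inner ℝ A.normal A.normal) • A.normal, fun h => ?_⟩
  have h0 : inner ℝ A.normal A.normal ≠ 0 := (real_inner_self_pos.2 hA).ne'
  rw [mem_sat_singleton, real_inner_smul_right, div_mul_cancel₀ _ h0] at h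
  linarith

/-- A half-space is not the whole space, so `{A}` is a minimal representation of it; uniqueness is
then applied to the second representation `{B}`. -/
theorem isPosMultiple_of_sat_eq {A B : LinearConstraint V} (hB : B.normal ≠ 0)
    (hint : (interior (sat {B})).Nonempty) (h : sat {B} = sat {A}) : IsPosMultiple B A := by
  obtain ⟨y, hy⟩ := exists_not_mem_sat_singleton hB
  have hA : A.normal ≠ 0 := by
    intro h0
    obtain ⟨x, hx⟩ := hint
    have hx := interior_subset hx
    rw [h, mem_sat_singleton] at hx hy
    rw [h0, inner_zero_left] at hx hy
    exact hy hx
  have hrep : IsMinimalRepresentation ({A} : Finset (LinearConstraint V)) (sat {B}) := by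
    refine ⟨by rw [Finset.coe_singleton, h], fun R' hR' => ?_⟩
    rw [Finset.card_singleton, Nat.one_le_iff_ne_zero, ne_eq, Finset.card_eq_zero]
    rintro rfl
    exact hy (hR' ▸ (by simp [sat]))
  obtain ⟨hne, hsp⟩ := hrep.spansHyperplane hint (Finset.mem_singleton_self A)
  obtain ⟨C, hC, hCA⟩ := exists_isPosMultiple (R := {B}) (by rw [Finset.coe_singleton]) hint hA
    h.subset hne hsp
  rwa [Finset.mem_singleton.1 hC] at hCA

variable {p : ℕ} {s : ℝ} {L : Finset (LinearConstraint V)}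

theorem isConeFacet_of_mem_setM
    (hc : ∀ i, (Ω i).offset = 1 ∨ (Ω i).offset = 0 ∨ (Ω i).offset = -1) (hp : 1 < p)
    (hs : s * s = 1) (hL : IsMinimalRepresentation L (hullH Ω p s))
    (hint : (interior (hullH Ω p s)).Nonempty) {A : LinearConstraint V}
    (hA : A ∈ setM Ω s L) : IsConeFacet Ω s (s * A.offset) A.normal := by
  obtain ⟨hAL, x, ⟨i, hi, rfl⟩, -, hx⟩ := hA
  exact isConeFacet_of_spansHyperplane_hullH hc hp hs
    (hL.1 ▸ sat_subset_sat_singleton (Finset.mem_coe.2 hAL))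
    (hL.spansHyperplane hint hAL).2 ⟨i, hi, hx⟩

/-- If the inequality were strict on P_s, it would be strict on every generator of H_s, each
containing some αᵢ of height s with positive weight. Yet an irredundant constraint is tight
somewhere on H_s. -/
theorem mem_setM_of_forall_le (hp : 1 < p)
    (hs : s * s = 1) (hL : IsMinimalRepresentation L (hullH Ω p s))
    (hint : (interior (hullH Ω p s)).Nonempty) {A : LinearConstraint V} (hA : A ∈ L)
    (h : ∀ i, s * A.offset * (Ω i).offset ≤ inner ℝ A.normal (Ω i).normal) :
    A ∈ setM Ω s L := by
  have hp1 : (1 : ℝ) < p := by exact_mod_cast hp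
  have hp2 : 0 < (p : ℝ) - 1 := sub_pos.2 hp1
  have hsr : s * A.offset * s = A.offset := by linear_combination A.offset * hs
  refine ⟨hA, ?_⟩
  by_contra! hcon
  have hP : ∀ i, (Ω i).offset = s → A.offset < inner ℝ A.normal (Ω i).normal := by
    intro i hi
    have h1 := h i
    rw [hi, hsr] at h1
    exact lt_of_le_of_ne h1 fun he => hcon _ ⟨i, hi, rfl⟩
      ⟨hL.normal_ne_zero (hint.mono interior_subset) hA, he.symm⟩
  have hsub : hullH Ω p s ⊆ {x | A.offset < inner ℝ A.normal x} := by
    refine hullH_subset ?_ hP (fun i j hi hj => ?_) fun i j hi hj => ?_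
    · exact convex_halfSpace_gt (innerₗ V A.normal).isLinear _
    · have h1 := hP i hi
      have h2 := h j
      rw [hj, mul_zero] at h2
      change _ < inner ℝ _ _
      rw [inner_add_right, real_inner_smul_right]
      nlinarith [mul_nonneg hp2.le h2]
    · have h1 := hP i hi
      have h2 := h j
      rw [hj, mul_neg, hsr] at h2
      change _ < inner ℝ _ _
      rw [inner_add_right, real_inner_smul_right, real_inner_smul_right]
      have e1 := mul_lt_mul_of_pos_left h1 (zero_lt_one.trans hp1)
      have e2 := mul_le_mul_of_nonneg_left h2 hp2.le
      linarith
  obtain ⟨x, hx, hxA⟩ := (hL.spansHyperplane hint hA).1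
  exact (hsub hx).ne' hxA

theorem IsConeFacet.isVertex_sat {q : ℝ} {n : V} (hn : IsConeFacet Ω s q n) (hq : 0 < q)
    (hs : s * s = 1) : IsVertex (q⁻¹ • n) (sat (Set.range Ω)) := by
  obtain ⟨hval, ⟨i₀, hi₀, hi₀t⟩, hdet⟩ := hn
  have hinner : ∀ i, inner ℝ (Ω i).normal (q⁻¹ • n) = inner ℝ n (Ω i).normal / q := fun i => by
    rw [real_inner_smul_right, real_inner_comm, inv_mul_eq_div]
  refine isVertex_sat_of_forall_tight ?_ fun u hu => ?_
  · rintro _ ⟨i, rfl⟩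
    rw [hinner, le_div_iff₀ hq, mul_comm]
    exact hval i
  · have hu' : ∀ i, inner ℝ n (Ω i).normal = q * (Ω i).offset →
        inner ℝ u (Ω i).normal = 0 := fun i hi => by
      rw [real_inner_comm]
      exact hu i (by rw [hinner, hi, mul_div_cancel_left₀ _ hq.ne'])
    obtain ⟨t, rfl⟩ := hdet u 0 fun i hi => by rw [hu' i hi, zero_mul]
    have h := hu' i₀ hi₀t
    rw [real_inner_smul_left, hi₀t, hi₀] at h
    have ht : t = 0 := (mul_eq_zero.1 h).resolve_right
      (mul_ne_zero hq.ne' (left_ne_zero_of_mul_eq_one hs))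
    rw [ht, zero_smul]

/-! ### The slices reg_c(Ω) -/

variable [Fintype ι]

theorem add_mem_reg {a b : ℝ} {x y : V} (hx : x ∈ reg a Ω) (hy : y ∈ reg b Ω) :
    x + y ∈ reg (a + b) Ω := by
  obtain ⟨w, hw, hwa, rfl⟩ := hx
  obtain ⟨z, hz, hzb, rfl⟩ := hy
  refine ⟨w + z, fun i => add_nonneg (hw i) (hz i), ?_, ?_⟩
  · simp only [Pi.add_apply, add_mul, Finset.sum_add_distrib]
    exact add_le_add hwa hzb
  · simp only [Pi.add_apply, add_smul, Finset.sum_add_distrib]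

theorem smul_mem_reg {a t : ℝ} {x : V} (ht : 0 ≤ t) (hx : x ∈ reg a Ω) :
    t • x ∈ reg (t * a) Ω := by
  obtain ⟨w, hw, hwa, rfl⟩ := hx
  refine ⟨fun i => t * w i, fun i => mul_nonneg ht (hw i), ?_, ?_⟩
  · simp only [mul_assoc, ← Finset.mul_sum]
    exact mul_le_mul_of_nonneg_left hwa ht
  · simp only [Finset.smul_sum, smul_smul]

theorem reg_anti {a b : ℝ} (h : a ≤ b) : reg b Ω ⊆ reg a Ω :=
  fun _ ⟨w, hw, hwb, hx⟩ => ⟨w, hw, h.trans hwb, hx⟩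

theorem zero_mem_reg : (0 : V) ∈ reg 0 Ω :=
  ⟨0, by simp, by simp, by simp⟩

theorem normal_mem_reg (i : ι) : (Ω i).normal ∈ reg (Ω i).offset Ω := by
  classical
  refine ⟨Pi.single i 1, fun j => ?_, ?_, ?_⟩
  · rw [Pi.single_apply]; split_ifs <;> norm_num
  · simp [Pi.single_apply]
  · simp [Pi.single_apply, ite_smul]

theorem sum_mem_reg {κ : Type*} (R : Finset κ) {f : κ → V} {g : κ → ℝ}
    (h : ∀ j ∈ R, f j ∈ reg (g j) Ω) : ∑ j ∈ R, f j ∈ reg (∑ j ∈ R, g j) Ω := by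
  classical
  induction R using Finset.induction_on with
  | empty => simpa using zero_mem_reg
  | insert a R ha ih =>
    rw [Finset.sum_insert ha, Finset.sum_insert ha]
    exact add_mem_reg (h a (Finset.mem_insert_self a R))
      (ih fun j hj => h j (Finset.mem_insert_of_mem hj))

theorem convex_reg (c : ℝ) : Convex ℝ (reg c Ω) := by
  intro x hx y hy a b ha hb hab
  have := add_mem_reg (smul_mem_reg ha hx) (smul_mem_reg hb hy)
  rwa [← add_mul, hab, one_mul] at this

/-- The generator (0, -1) absorbs any excess height without moving `x`. -/
theorem exists_eq_of_mem_reg (htriv : ∃ i, (Ω i).normal = 0 ∧ (Ω i).offset = -1) {c : ℝ} {x : V}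
    (hx : x ∈ reg c Ω) : ∃ w : ι → ℝ, (∀ i, 0 ≤ w i) ∧ ∑ i, w i * (Ω i).offset = c ∧
      x = ∑ i, w i • (Ω i).normal := by
  classical
  obtain ⟨i, hi0, hi1⟩ := htriv
  obtain ⟨w, hw, hwc, rfl⟩ := hx
  refine ⟨w + Pi.single i (∑ i, w i * (Ω i).offset - c), fun j => ?_, ?_, ?_⟩
  · refine add_nonneg (hw j) ?_
    rw [Pi.single_apply]
    split_ifs
    · exact sub_nonneg.2 hwc
    · exact le_rfl
  · simp only [Pi.add_apply, add_mul, Finset.sum_add_distrib, Pi.single_apply, ite_mul, zero_mul,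
      Finset.sum_ite_eq', Finset.mem_univ, if_true, hi1]
    ring
  · simp only [Pi.add_apply, add_smul, Finset.sum_add_distrib, Pi.single_apply, ite_smul,
      zero_smul, Finset.sum_ite_eq', Finset.mem_univ, if_true, hi0, smul_zero, add_zero]

theorem le_inner_of_mem_reg {c : ℝ} {x b : V} (hx : x ∈ reg c Ω) (hb : b ∈ sat (Set.range Ω)) :
    c ≤ inner ℝ x b := by
  obtain ⟨w, hw, hwc, rfl⟩ := hx
  rw [sum_inner]
  refine hwc.trans (Finset.sum_le_sum fun i _ => ?_)
  rw [real_inner_smul_left]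
  exact mul_le_mul_of_nonneg_left (hb _ ⟨i, rfl⟩) (hw i)

/-- Vertices of `reg s Ω` span extreme rays of the cone generated by the pairs `(αᵢ, cᵢ)`. -/
theorem IsVertex.eq_smul_of_add {s h : ℝ} (hs : s * s = 1) {x u v : V}
    (hx : IsVertex x (reg s Ω)) (hu : u ∈ reg h Ω) (hv : v ∈ reg (s - h) Ω) (huv : u + v = x) :
    u = (h * s) • x := by
  obtain ⟨-, hext⟩ := isVertex_iff.1 hx
  -- The perturbations (1 ∓ ε)u + v have height (1 ∓ e)s. For this ε both factors are positive, so
  -- the points can be rescaled to height s, and `x` lies strictly between the results with weights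
  -- (1 ∓ e)/2.
  set ε : ℝ := 1 / (2 * (1 + |h|)) with hε
  have hε0 : 0 < ε := by positivity
  have hε1 : ε * (2 * (1 + |h|)) = 1 := by rw [hε]; field_simp
  have habs : |ε * h * s| < 1 := by
    have hs1 : |s| = 1 := by
      have : |s| * |s| = 1 := by rw [← abs_mul, hs, abs_one]
      nlinarith [abs_nonneg s]
    rw [abs_mul, hs1, mul_one, abs_mul, abs_of_pos hε0]
    nlinarith [abs_nonneg h]
  obtain ⟨h1, h2⟩ := abs_lt.1 habs
  set e : ℝ := ε * h * s with he
  have hes : s * e = ε * h := by rw [he]; linear_combination ε * h * hs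
  have hm : 0 < 1 - e := by linarith
  have hp : 0 < 1 + e := by linarith
  have hε2 : 0 ≤ 1 - ε := by nlinarith [abs_nonneg h]
  have hX : (1 - e)⁻¹ • ((1 - ε) • u + v) ∈ reg s Ω := by
    have := smul_mem_reg (inv_pos.2 hm).le (add_mem_reg (smul_mem_reg hε2 hu) hv)
    have heq : (1 - e)⁻¹ * ((1 - ε) * h + (s - h)) = s := by
      rw [inv_mul_eq_iff_eq_mul₀ hm.ne']; linear_combination hes
    rwa [heq] at this
  have hY : (1 + e)⁻¹ • ((1 + ε) • u + v) ∈ reg s Ω := by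
    have := smul_mem_reg (inv_pos.2 hp).le
      (add_mem_reg (smul_mem_reg (by positivity : 0 ≤ 1 + ε) hu) hv)
    have heq : (1 + e)⁻¹ * ((1 + ε) * h + (s - h)) = s := by
      rw [inv_mul_eq_iff_eq_mul₀ hp.ne']; linear_combination -hes
    rwa [heq] at this
  have hy := (hext _ hX _ hY ((1 - e) / 2) (by linarith) (by linarith) (by
    have e1 : (1 - e) / 2 * (1 - e)⁻¹ = 1 / 2 := by field_simp
    have e2 : (1 - (1 - e) / 2) * (1 + e)⁻¹ = 1 / 2 := by field_simp; ring
    rw [smul_smul, smul_smul, e1, e2, ← huv]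
    module)).2
  rw [inv_smul_eq_iff₀ hp.ne', ← huv] at hy
  have hy' : ε • u = ε • ((h * s) • x) := by
    have : ε • u = e • (u + v) := by
      have h3 : ε • u = (1 + ε) • u + v - (u + v) := by module
      rw [h3, hy]
      module
    rw [this, huv, smul_smul, he, mul_assoc]
  exact smul_right_injective V hε0.ne' hy'

theorem IsVertex.eq_smul_of_sum {s : ℝ} (hs : s * s = 1) {x : V} (hx : IsVertex x (reg s Ω))
    {κ : Type*} (R : Finset κ) {f : κ → V} {g : κ → ℝ} (h : ∀ j ∈ R, f j ∈ reg (g j) Ω)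
    (hsum : x = ∑ j ∈ R, f j) (hg : s ≤ ∑ j ∈ R, g j) {j : κ} (hj : j ∈ R) :
    f j = (g j * s) • x := by
  classical
  refine IsVertex.eq_smul_of_add hs hx (h j hj)
    (reg_anti ?_ (sum_mem_reg (R.erase j) fun k hk => h k (Finset.mem_of_mem_erase hk)))
    (by rw [Finset.add_sum_erase R f hj, hsum])
  rw [← Finset.add_sum_erase R g hj] at hg
  linarith

theorem hullH_subset_reg {p : ℕ} (hp : 1 < p) {s : ℝ} : hullH Ω p s ⊆ reg s Ω := by
  have hp1 : (0 : ℝ) ≤ (p : ℝ) - 1 := by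
    have : (1 : ℝ) < p := by exact_mod_cast hp
    linarith
  refine hullH_subset (convex_reg s) (fun i hi => hi ▸ normal_mem_reg i) (fun i j hi hj => ?_)
    fun i j hi hj => ?_
  · have := add_mem_reg (normal_mem_reg (Ω := Ω) i) (smul_mem_reg hp1 (normal_mem_reg (Ω := Ω) j))
    rwa [hi, hj, mul_zero, add_zero] at this
  · have := add_mem_reg (smul_mem_reg (Nat.cast_nonneg p) (normal_mem_reg (Ω := Ω) i))
      (smul_mem_reg hp1 (normal_mem_reg (Ω := Ω) j))
    rw [hi, hj] at this
    have heq : (p : ℝ) * s + ((p : ℝ) - 1) * -s = s := by ring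
    rwa [heq] at this

theorem reg_subset_sat_singleton (htriv : ∃ i, (Ω i).normal = 0 ∧ (Ω i).offset = -1) {s : ℝ}
    (hs : s * s = 1) {A : LinearConstraint V}
    (hA : ∀ i, s * A.offset * (Ω i).offset ≤ inner ℝ A.normal (Ω i).normal) :
    reg s Ω ⊆ sat {A} := by
  intro x hx
  obtain ⟨w, hw, hws, rfl⟩ := exists_eq_of_mem_reg htriv hx
  rw [mem_sat_singleton, inner_sum]
  calc A.offset = s * A.offset * s := by linear_combination -A.offset * hs
    _ = ∑ i, w i * (s * A.offset * (Ω i).offset) := by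
        conv_lhs => rw [← hws, Finset.mul_sum]
        exact Finset.sum_congr rfl fun i _ => by rw [hws]; ring
    _ ≤ _ := Finset.sum_le_sum fun i _ => by
        rw [real_inner_smul_right]
        exact mul_le_mul_of_nonneg_left (hA i) (hw i)

theorem IsConeFacet.spansHyperplane_reg
    (hc : ∀ i, (Ω i).offset = 1 ∨ (Ω i).offset = 0 ∨ (Ω i).offset = -1)
    {s : ℝ} (hs : s * s = 1) {A : LinearConstraint V}
    (hA : IsConeFacet Ω s (s * A.offset) A.normal) :
    (tightSet (reg s Ω) A).Nonempty ∧ SpansHyperplane (tightSet (reg s Ω) A) A.normal := by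
  -- Any p > 1 would do; p = 2 provides enough tight points inside reg_s(Ω).
  obtain ⟨hne, hsp⟩ := IsConeFacet.spansHyperplane_hullH hc one_lt_two hs hA
  exact ⟨hne.mono fun x hx => ⟨hullH_subset_reg one_lt_two hx.1, hx.2⟩,
    fun u k hu => hsp u k fun x hx => hu x ⟨hullH_subset_reg one_lt_two hx.1, hx.2⟩⟩

/-- For a tight `x`, the point (1 - s cᵢ)x + αᵢ is again in reg_s(Ω), its first coefficient being 0,
1 or 2. Validity there is the claim. -/
theorem le_inner_normal_of_reg_subset
    (hc : ∀ i, (Ω i).offset = 1 ∨ (Ω i).offset = 0 ∨ (Ω i).offset = -1)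
    {s : ℝ} (hs : s * s = 1) {A : LinearConstraint V} (hA : reg s Ω ⊆ sat {A})
    (hne : (tightSet (reg s Ω) A).Nonempty) (i : ι) :
    s * A.offset * (Ω i).offset ≤ inner ℝ A.normal (Ω i).normal := by
  obtain ⟨x, hx, hxt⟩ := hne
  have h0 : 0 ≤ 1 - s * (Ω i).offset := by
    rcases offset_cases (hc i) hs with h | h | h <;> rw [h] <;> nlinarith
  have h1 := add_mem_reg (smul_mem_reg h0 hx) (normal_mem_reg (Ω := Ω) i)
  have h2 : (1 - s * (Ω i).offset) * s + (Ω i).offset = s := by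
    linear_combination -(Ω i).offset * hs
  rw [h2] at h1
  have h3 := mem_sat_singleton.1 (hA h1)
  rw [inner_add_right, real_inner_smul_right, hxt] at h3
  linarith

theorem isConeFacet_of_spansHyperplane_reg
    (hc : ∀ i, (Ω i).offset = 1 ∨ (Ω i).offset = 0 ∨ (Ω i).offset = -1)
    (htriv : ∃ i, (Ω i).normal = 0 ∧ (Ω i).offset = -1)
    {s : ℝ} (hs : s * s = 1) {A : LinearConstraint V} (hA : reg s Ω ⊆ sat {A})
    (hne : (tightSet (reg s Ω) A).Nonempty)
    (hsp : SpansHyperplane (tightSet (reg s Ω) A) A.normal) :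
    IsConeFacet Ω s (s * A.offset) A.normal := by
  have hval := le_inner_normal_of_reg_subset hc hs hA hne
  have hsr : s * A.offset * s = A.offset := by linear_combination A.offset * hs
  -- Complementary slackness: a tight point only uses tight pairs.
  have key : ∀ x ∈ tightSet (reg s Ω) A, ∃ w : ι → ℝ, (∀ i, 0 ≤ w i) ∧
      ∑ i, w i * (Ω i).offset = s ∧ x = ∑ i, w i • (Ω i).normal ∧
      ∀ i, w i = 0 ∨ inner ℝ A.normal (Ω i).normal = s * A.offset * (Ω i).offset := by
    rintro x ⟨hx, hxt⟩
    obtain ⟨w, hw, hws, rfl⟩ := exists_eq_of_mem_reg htriv hx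
    refine ⟨w, hw, hws, rfl, ?_⟩
    have hsum : ∑ i, w i * (inner ℝ A.normal (Ω i).normal - s * A.offset * (Ω i).offset) = 0 := by
      have h1 : ∑ i, w i * inner ℝ A.normal (Ω i).normal = A.offset := by
        rw [← hxt, inner_sum]
        simp only [real_inner_smul_right]
      have h2 : ∑ i, w i * (s * A.offset * (Ω i).offset) = A.offset := by
        calc _ = s * A.offset * ∑ i, w i * (Ω i).offset := by
              rw [Finset.mul_sum]
              exact Finset.sum_congr rfl fun i _ => by ring
          _ = A.offset := by rw [hws, hsr]
      simp only [mul_sub, Finset.sum_sub_distrib, h1, h2, sub_self]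
    intro i
    have := (Finset.sum_eq_zero_iff_of_nonneg
      fun i _ => mul_nonneg (hw i) (sub_nonneg.2 (hval i))).1 hsum i (Finset.mem_univ i)
    exact (mul_eq_zero.1 this).imp id sub_eq_zero.1
  refine ⟨hval, ?_, fun u k hu => hsp u (k * s) fun x hx => ?_⟩
  · obtain ⟨x, hx⟩ := hne
    obtain ⟨w, hw, hws, -, hwt⟩ := key x hx
    -- The sum is s² = 1, so some term is positive, which is possible only for a pair of height s.
    have hpos : ∑ _i : ι, (0 : ℝ) < ∑ i, w i * (Ω i).offset * s := by
      rw [← Finset.sum_mul, hws, hs, Finset.sum_const_zero]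
      exact one_pos
    obtain ⟨i, -, hi⟩ := Finset.exists_lt_of_sum_lt hpos
    refine ⟨i, ?_, (hwt i).resolve_left fun h => by simp [h] at hi⟩
    rcases offset_cases (hc i) hs with h | h | h
    · exact h
    · simp [h] at hi
    · rw [h] at hi
      nlinarith [hw i]
  · obtain ⟨w, hw, hws, rfl, hwt⟩ := key x hx
    rw [inner_sum, ← hws, Finset.mul_sum]
    refine Finset.sum_congr rfl fun i _ => ?_
    rw [real_inner_smul_right]
    rcases hwt i with h | h
    · simp [h]
    · rw [hu i h]; ring

/-! ### Correspondence between faces, representations and M_s -/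

theorem IsVertex.eq_zero_of_forall_tight {v : V} (hv : IsVertex v (sat (Set.range Ω))) {u : V}
    (hu : ∀ i, inner ℝ (Ω i).normal v = (Ω i).offset → inner ℝ (Ω i).normal u = 0) : u = 0 := by
  classical
  obtain ⟨hvX, hext⟩ := isVertex_iff.1 hv
  set R : Finset (LinearConstraint V) := (Finset.univ.image Ω).filter
    (fun A => inner ℝ A.normal v ≠ A.offset) with hR
  have hvR : ∀ A ∈ R, A.offset < inner ℝ A.normal v := by
    intro A hA
    obtain ⟨hA, hne⟩ := Finset.mem_filter.1 hA
    obtain ⟨i, -, rfl⟩ := Finset.mem_image.1 hA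
    exact lt_of_le_of_ne (hvX _ ⟨i, rfl⟩) hne.symm
  have hmem : ∀ ε : ℝ, (∀ A ∈ R, A.offset < inner ℝ A.normal (v + ε • u)) →
      v + ε • u ∈ sat (Set.range Ω) := by
    rintro ε h _ ⟨i, rfl⟩
    by_cases hi : inner ℝ (Ω i).normal v = (Ω i).offset
    · rw [inner_add_right, real_inner_smul_right, hu i hi, hi, mul_zero, add_zero]
    · exact (h _ (Finset.mem_filter.2 ⟨Finset.mem_image_of_mem Ω (Finset.mem_univ i), hi⟩)).le
  -- Intersecting with the reflection through `v` gives one ε for both v + εu and v - εu, whose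
  -- midpoint is the vertex.
  have hU := (isOpen_strict R).inter ((isOpen_strict R).preimage
    (by fun_prop : Continuous fun y : V => (2 : ℝ) • v - y))
  have hvU : v ∈ {x : V | ∀ A ∈ R, A.offset < inner ℝ A.normal x} ∩
      (fun y : V => (2 : ℝ) • v - y) ⁻¹' {x : V | ∀ A ∈ R, A.offset < inner ℝ A.normal x} := by
    refine ⟨hvR, ?_⟩
    have : (2 : ℝ) • v - v = v := by module
    rw [Set.mem_preimage, this]
    exact hvR
  obtain ⟨ε, hε, h1, h2⟩ := exists_pos_add_smul_mem (hU.mem_nhds hvU) u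
  have h3 : (2 : ℝ) • v - (v + ε • u) = v + (-ε) • u := by module
  rw [Set.mem_preimage, h3] at h2
  have := (hext _ (hmem ε h1) _ (hmem (-ε) h2) (1 / 2) (by norm_num) (by norm_num)
    (by module)).1
  exact (smul_eq_zero.1 (add_eq_left.1 this)).resolve_left hε.ne'

theorem memUpToNormalisation_iff {R : Finset (LinearConstraint V)} {X : Set V}
    (hR : IsMinimalRepresentation R X) (hX : (interior X).Nonempty) {A : LinearConstraint V} :
    MemUpToNormalisation A R ↔ ∃ B ∈ R, IsPosMultiple B A := by
  refine ⟨fun ⟨B, hB, h⟩ => ⟨B, hB, isPosMultiple_of_sat_eq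
    (hR.normal_ne_zero (hX.mono interior_subset) hB) (hX.mono (interior_mono ?_)) h⟩,
    fun ⟨B, hB, h⟩ => ⟨B, hB, h.sat_eq⟩⟩
  rw [← hR.1]
  exact sat_subset_sat_singleton hB

theorem subset_sat_and_isFacet_iff [FiniteDimensional ℝ V] {R : Finset (LinearConstraint V)}
    {X : Set V} (hR : IsMinimalRepresentation R X) (hX : Nondegenerate X)
    (A : LinearConstraint V) :
    (X ⊆ sat {A} ∧ IsFacet (tightSet X A) X) ↔ MemUpToNormalisation A R := by
  have hc : Convex ℝ X := hR.1 ▸ convex_sat _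
  have hint := hX.interior_nonempty hc
  rw [memUpToNormalisation_iff hR hint]
  constructor
  · rintro ⟨hXA, hF⟩
    have hA : A.normal ≠ 0 := by
      intro h0
      obtain ⟨K, hK, ⟨x, hx, hxA⟩, -, -, hdim, -⟩ := hF
      have : tightSet X A = X :=
        Set.Subset.antisymm (fun y hy => hy.1) fun y hy => ⟨hy, by
          rw [h0, inner_zero_left] at hxA ⊢
          exact hxA⟩
      rw [this, hX.2] at hdim
      omega
    obtain ⟨hne, hsp⟩ := (isFacet_tightSet_iff hc hA hXA).1 hF
    exact exists_isPosMultiple hR.1 hint hA hXA hne hsp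
  · rintro ⟨B, hB, hBA⟩
    have hXB : X ⊆ sat {B} := hR.1 ▸ sat_subset_sat_singleton (Finset.mem_coe.2 hB)
    rw [← hBA.sat_eq, ← hBA.tightSet_eq]
    exact ⟨hXB, (isFacet_tightSet_iff hc (hR.normal_ne_zero hX.1 hB) hXB).2
      (hR.spansHyperplane hint hB)⟩

theorem IsFacet.exists_mem_representation [FiniteDimensional ℝ V]
    {R : Finset (LinearConstraint V)} {X : Set V} (hR : IsMinimalRepresentation R X)
    (hX : Nondegenerate X) {F : Set V} (hF : IsFacet F X) : ∃ A ∈ R, F = tightSet X A := by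
  have hc : Convex ℝ X := hR.1 ▸ convex_sat _
  have hint := hX.interior_nonempty hc
  obtain ⟨A, hA, hXA, rfl⟩ := hF.exists_eq_tightSet hc hint
  obtain ⟨hne, hsp⟩ := (isFacet_tightSet_iff hc hA hXA).1 hF
  obtain ⟨B, hB, hBA⟩ := exists_isPosMultiple hR.1 hint hA hXA hne hsp
  exact ⟨B, hB, (hBA.tightSet_eq X).symm⟩

theorem exists_isPosMultiple_of_mem {R : Finset (LinearConstraint V)}
    (hR : IsMinimalRepresentation R (sat (Set.range Ω)))
    (hint : (interior (sat (Set.range Ω))).Nonempty) {A : LinearConstraint V} (hA : A ∈ R) :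
    ∃ i, IsPosMultiple (Ω i) A := by
  classical
  obtain ⟨hne, hsp⟩ := hR.spansHyperplane hint hA
  obtain ⟨B, hB, h⟩ := exists_isPosMultiple (R := Finset.univ.image Ω) (by simp) hint
    (hR.normal_ne_zero (hint.mono interior_subset) hA)
    (hR.1 ▸ sat_subset_sat_singleton (Finset.mem_coe.2 hA)) hne hsp
  obtain ⟨i, -, rfl⟩ := Finset.mem_image.1 hB
  exact ⟨i, h⟩

theorem isVertex_normal_of_isPosMultiple {R : Finset (LinearConstraint V)}
    (hR : IsMinimalRepresentation R (sat (Set.range Ω)))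
    (hint : (interior (sat (Set.range Ω))).Nonempty) {s : ℝ} (hs : s * s = 1) {i : ι}
    (hi : (Ω i).offset = s) {B : LinearConstraint V} (hB : B ∈ R)
    (hBi : IsPosMultiple B (Ω i)) : IsVertex (Ω i).normal (reg s Ω) ∧ (Ω i).normal ≠ 0 := by
  have hs0 : s ≠ 0 := left_ne_zero_of_mul_eq_one hs
  have hB0 := hR.normal_ne_zero (hint.mono interior_subset) hB
  obtain ⟨hne, hsp⟩ := hR.spansHyperplane hint hB
  rw [hBi.tightSet_eq] at hne hsp
  obtain ⟨t, ht, hn, -⟩ := hBi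
  -- The tight set determines its normal up to scale, and the nonzero value s fixes the scale.
  have key : ∀ x : V, (∀ b ∈ tightSet (sat (Set.range Ω)) (Ω i), inner ℝ x b = s) →
      x = (Ω i).normal := by
    intro x hx
    obtain ⟨r, hr⟩ := hsp x s hx
    obtain ⟨b, hb⟩ := hne
    rw [hn, smul_smul] at hr
    have h1 := hx b hb
    rw [hr, real_inner_smul_left, hb.2, hi] at h1
    have h2 : r * t = 1 := mul_right_cancel₀ hs0 (by rw [h1, one_mul])
    rw [hr, h2, one_smul]
  refine ⟨isVertex_iff.2 ⟨hi ▸ normal_mem_reg i, fun x hx y hy μ h0 h1 he => ?_⟩, ?_⟩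
  · have h1' : 0 < 1 - μ := sub_pos.2 h1
    have hxy : ∀ b ∈ tightSet (sat (Set.range Ω)) (Ω i), inner ℝ x b = s ∧ inner ℝ y b = s := by
      intro b hb
      have e := hb.2
      rw [he, hi, inner_add_left, real_inner_smul_left, real_inner_smul_left] at e
      have e1 := mul_nonneg h0.le (sub_nonneg.2 (le_inner_of_mem_reg hx hb.1))
      have e2 := mul_nonneg h1'.le (sub_nonneg.2 (le_inner_of_mem_reg hy hb.1))
      have f1 : μ * (inner ℝ x b - s) = 0 := by linarith
      have f2 : (1 - μ) * (inner ℝ y b - s) = 0 := by linarith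
      exact ⟨sub_eq_zero.1 ((mul_eq_zero.1 f1).resolve_left h0.ne'),
        sub_eq_zero.1 ((mul_eq_zero.1 f2).resolve_left h1'.ne')⟩
    exact ⟨key x fun b hb => (hxy b hb).1, key y fun b hb => (hxy b hb).2⟩
  · intro h
    rw [h, smul_zero] at hn
    exact hB0 hn

/-- Farkas writes αᵢ as a nonnegative combination of the normals in `R` with height at least s. Each
term belongs to the cone, so extremality makes a nonzero term a multiple of (αᵢ, s); strictness at
an interior point makes the factor positive. -/
theorem exists_isPosMultiple_of_isVertex_normal [FiniteDimensional ℝ V]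
    {R : Finset (LinearConstraint V)} (hR : IsMinimalRepresentation R (sat (Set.range Ω)))
    (hint : (interior (sat (Set.range Ω))).Nonempty) {s : ℝ} (hs : s * s = 1) {i : ι}
    (hi : (Ω i).offset = s) (hv : IsVertex (Ω i).normal (reg s Ω)) (h0 : (Ω i).normal ≠ 0) :
    ∃ B ∈ R, IsPosMultiple B (Ω i) := by
  have hsub : ∀ A ∈ R, sat (Set.range Ω) ⊆ sat {A} := fun A hA =>
    hR.1 ▸ sat_subset_sat_singleton (Finset.mem_coe.2 hA)
  obtain ⟨b, hb⟩ := id hint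
  have hbR : ∀ A ∈ R, A.offset < inner ℝ A.normal b := fun A hA =>
    lt_of_mem_interior (hR.normal_ne_zero ⟨b, interior_subset hb⟩ hA) (hsub A hA) hb
  have hbi : (Ω i).offset < inner ℝ (Ω i).normal b :=
    lt_of_mem_interior h0 (sat_subset_sat_singleton (Set.mem_range_self i)) hb
  obtain ⟨w, hw, hwn, hwo⟩ := exists_nonneg_combination hbR hbi
    (by rw [hR.1]; exact sat_subset_sat_singleton (Set.mem_range_self i))
  have hmem : ∀ A ∈ R, w A • A.normal ∈ reg (w A * A.offset) Ω := by
    intro A hA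
    obtain ⟨j, hj⟩ := exists_isPosMultiple_of_mem hR hint hA
    obtain ⟨t, ht, hn, ho⟩ := hj.symm
    rw [hn, ho]
    exact smul_mem_reg (hw A hA) (smul_mem_reg ht.le (normal_mem_reg j))
  obtain ⟨A, hA, hA0⟩ : ∃ A ∈ R, w A • A.normal ≠ 0 := by
    by_contra! h
    exact h0 (hwn.trans (Finset.sum_eq_zero h))
  have hw0 : 0 < w A := lt_of_le_of_ne (hw A hA) fun h => hA0 (by rw [← h, zero_smul])
  have heq := hv.eq_smul_of_sum hs R hmem hwn (hi ▸ hwo) hA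
  set h := w A * A.offset with hh
  have hpos : 0 < h * s := by
    have h1 : h < inner ℝ (w A • A.normal) b := by
      rw [real_inner_smul_left]
      exact mul_lt_mul_of_pos_left (hbR A hA) hw0
    rw [heq, real_inner_smul_left] at h1
    have h2 : h * s * s = h := by rw [mul_assoc, hs, mul_one]
    rw [hi] at hbi
    by_contra! hle
    nlinarith
  refine ⟨A, hA, (w A)⁻¹ * (h * s), mul_pos (inv_pos.2 hw0) hpos, ?_, ?_⟩
  · rw [← smul_smul, ← heq, inv_smul_smul₀ hw0.ne']
  · rw [hi, mul_assoc, mul_assoc h, hs, mul_one, hh, inv_mul_cancel_left₀ hw0.ne']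

theorem IsVertex.exists_normal_eq
    (hc : ∀ i, (Ω i).offset = 1 ∨ (Ω i).offset = 0 ∨ (Ω i).offset = -1)
    (hint : (interior (sat (Set.range Ω))).Nonempty) {s : ℝ} (hs : s * s = 1) {x : V}
    (hx : IsVertex x (reg s Ω)) (hx0 : x ≠ 0) : ∃ i, (Ω i).offset = s ∧ (Ω i).normal = x := by
  obtain ⟨b, hb⟩ := hint
  have hxr := (isVertex_iff.1 hx).1
  obtain ⟨w, hw, hws, hwx⟩ := id hxr
  obtain ⟨i, hi0⟩ : ∃ i, w i • (Ω i).normal ≠ 0 := by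
    by_contra! h
    exact hx0 (hwx.trans (Finset.sum_eq_zero fun i _ => h i))
  have heq := hx.eq_smul_of_sum hs Finset.univ
    (fun i _ => smul_mem_reg (hw i) (normal_mem_reg (Ω := Ω) i)) hwx hws (Finset.mem_univ i)
  have hw0 : w i ≠ 0 := left_ne_zero_of_smul hi0
  have hn0 : (Ω i).normal ≠ 0 := right_ne_zero_of_smul hi0
  rw [mul_assoc, mul_smul] at heq
  have heq := smul_right_injective V hw0 heq
  rcases offset_cases (hc i) hs with h | h | h
  · rw [h, hs, one_smul] at heq
    exact ⟨i, h, heq⟩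
  · rw [h, zero_mul, zero_smul] at heq
    exact absurd heq hn0
  -- Here αᵢ = -x has height -s, so x·b < s at an interior point `b`, against x·b ≥ s for x in
  -- reg_s(Ω).
  · exfalso
    have h1 := lt_of_mem_interior hn0 (sat_subset_sat_singleton (S := Set.range Ω) ⟨i, rfl⟩) hb
    have h2 := le_inner_of_mem_reg hxr (interior_subset hb)
    rw [heq, h, neg_mul, hs, real_inner_smul_left] at h1
    linarith

theorem IsConeFacet.exists_mem_setM
    (hc : ∀ i, (Ω i).offset = 1 ∨ (Ω i).offset = 0 ∨ (Ω i).offset = -1)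
    (htriv : ∃ i, (Ω i).normal = 0 ∧ (Ω i).offset = -1) (hp : 1 < p)
    (hs : s * s = 1) (hL : IsMinimalRepresentation L (hullH Ω p s))
    (hint : (interior (hullH Ω p s)).Nonempty) {A : LinearConstraint V} (hA0 : A.normal ≠ 0)
    (hA : IsConeFacet Ω s (s * A.offset) A.normal) :
    ∃ B ∈ setM Ω s L, IsPosMultiple B A := by
  obtain ⟨hne, hsp⟩ := hA.spansHyperplane_hullH hc hp hs
  obtain ⟨B, hB, hBA⟩ := exists_isPosMultiple hL.1 hint hA0
    ((hullH_subset_reg hp).trans (reg_subset_sat_singleton htriv hs hA.1)) hne hsp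
  refine ⟨B, ⟨hB, ?_⟩, hBA⟩
  obtain ⟨i, hi, hit⟩ := hA.2.1
  obtain ⟨t, ht, hn, ho⟩ := hBA
  refine ⟨_, ⟨i, hi, rfl⟩, hL.normal_ne_zero (hint.mono interior_subset) hB, ?_⟩
  rw [hn, ho, real_inner_smul_left, hit, hi]
  linear_combination t * A.offset * hs

theorem isFacet_tightSet_reg_iff [FiniteDimensional ℝ V]
    (hc : ∀ i, (Ω i).offset = 1 ∨ (Ω i).offset = 0 ∨ (Ω i).offset = -1)
    (htriv : ∃ i, (Ω i).normal = 0 ∧ (Ω i).offset = -1) (hp : 1 < p)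
    (hs : s * s = 1) (hL : IsMinimalRepresentation L (hullH Ω p s))
    (hint : (interior (hullH Ω p s)).Nonempty) {A : LinearConstraint V} (hA : A ∈ L) :
    IsFacet (tightSet (reg s Ω) A) (reg s Ω) ↔ A ∈ setM Ω s L := by
  have hA0 := hL.normal_ne_zero (hint.mono interior_subset) hA
  constructor
  · intro hF
    have hsub := IsFacet.subset_sat hA0 (hullH_subset_reg hp)
      (hL.1 ▸ sat_subset_sat_singleton (Finset.mem_coe.2 hA)) hint (convex_reg s) hF
    obtain ⟨K, -, hne, -⟩ := hF
    exact mem_setM_of_forall_le hp hs hL hint hA (le_inner_normal_of_reg_subset hc hs hsub hne)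
  · intro hM
    have hcf := isConeFacet_of_mem_setM hc hp hs hL hint hM
    exact (isFacet_tightSet_iff (convex_reg s) hA0
      (reg_subset_sat_singleton htriv hs hcf.1)).2 (hcf.spansHyperplane_reg hc hs)

theorem IsFacet.exists_mem_setM [FiniteDimensional ℝ V]
    (hc : ∀ i, (Ω i).offset = 1 ∨ (Ω i).offset = 0 ∨ (Ω i).offset = -1)
    (htriv : ∃ i, (Ω i).normal = 0 ∧ (Ω i).offset = -1) (hp : 1 < p)
    (hs : s * s = 1) (hL : IsMinimalRepresentation L (hullH Ω p s))
    (hint : (interior (hullH Ω p s)).Nonempty) {F : Set V} (hF : IsFacet F (reg s Ω)) :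
    ∃ A ∈ setM Ω s L, F = tightSet (reg s Ω) A := by
  obtain ⟨A, hA0, hsub, rfl⟩ := hF.exists_eq_tightSet (convex_reg s)
    (hint.mono (interior_mono (hullH_subset_reg hp)))
  obtain ⟨hne, hsp⟩ := (isFacet_tightSet_iff (convex_reg s) hA0 hsub).1 hF
  obtain ⟨B, hB, hBA⟩ := (isConeFacet_of_spansHyperplane_reg hc htriv hs hsub hne
    hsp).exists_mem_setM hc htriv hp hs hL hint hA0
  exact ⟨B, hB, (hBA.tightSet_eq _).symm⟩

theorem isVertex_sat_iff_mem_setM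
    (hc : ∀ i, (Ω i).offset = 1 ∨ (Ω i).offset = 0 ∨ (Ω i).offset = -1)
    (htriv : ∃ i, (Ω i).normal = 0 ∧ (Ω i).offset = -1) (hp : 1 < p)
    (hs : s * s = 1) (hL : IsMinimalRepresentation L (hullH Ω p s))
    (hint : (interior (hullH Ω p s)).Nonempty) {A : LinearConstraint V} (hA : A ∈ L)
    (hA0 : A.offset ≠ 0) :
    IsVertex (|A.offset|⁻¹ • A.normal) (sat (Set.range Ω)) ↔ A ∈ setM Ω s L := by
  have hs0 : s ≠ 0 := left_ne_zero_of_mul_eq_one hs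
  have hsabs : |s * A.offset| = |A.offset| := by
    rcases mul_self_eq_one_iff.1 hs with rfl | rfl <;> simp
  have habs : 0 < |A.offset| := abs_pos.2 hA0
  constructor
  · intro hv
    have hval : ∀ i, |A.offset| * (Ω i).offset ≤ inner ℝ A.normal (Ω i).normal := by
      intro i
      have := (isVertex_iff.1 hv).1 _ ⟨i, rfl⟩
      rwa [real_inner_smul_right, real_inner_comm, inv_mul_eq_div, le_div_iff₀ habs,
        mul_comm] at this
    -- The offset has the sign of s. For s = 1, a tight point of H_s satisfies the inequality with
    -- right-hand side |r|, so |r| ≤ r; for s = -1, the origin is in H_s, so r ≤ 0.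
    have hq : s * A.offset = |A.offset| := by
      rcases mul_self_eq_one_iff.1 hs with rfl | rfl
      · rw [one_mul]
        obtain ⟨x, hx, hxA⟩ := (hL.spansHyperplane hint hA).1
        have := mem_sat_singleton.1 (reg_subset_sat_singleton htriv hs
          (A := ⟨A.normal, |A.offset|⟩) (fun i => by rw [one_mul]; exact hval i)
          (hullH_subset_reg hp hx))
        rw [hxA] at this
        exact le_antisymm (le_abs_self _) this
      · obtain ⟨i, hi, hi'⟩ := htriv
        have := mem_sat_singleton.1 ((hL.1 ▸ sat_subset_sat_singleton (Finset.mem_coe.2 hA) :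
          hullH Ω p (-1) ⊆ sat {A}) (mem_hullH_P hi'))
        rw [hi, inner_zero_right] at this
        rw [abs_of_nonpos this, neg_one_mul]
    exact mem_setM_of_forall_le hp hs hL hint hA (by rw [hq]; exact hval)
  · intro hM
    have hcf := isConeFacet_of_mem_setM hc hp hs hL hint hM
    obtain ⟨i, hi, hi'⟩ := htriv
    have h := hcf.1 i
    rw [hi, hi', inner_zero_right] at h
    have hq : 0 < s * A.offset :=
      lt_of_le_of_ne (by linarith) (mul_ne_zero hs0 hA0).symm
    rw [← hsabs, abs_of_pos hq]
    exact hcf.isVertex_sat hq hs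

theorem IsVertex.exists_isConeFacet
    (hc : ∀ i, (Ω i).offset = 1 ∨ (Ω i).offset = 0 ∨ (Ω i).offset = -1) {v : V}
    (hv : IsVertex v (sat (Set.range Ω))) (hv0 : v ≠ 0) :
    ∃ s ∈ signs Ω, IsConeFacet Ω s 1 v := by
  -- If all tight constraints had offset 0, then `v` would be orthogonal to all tight normals and
  -- hence zero.
  obtain ⟨i, hit, hi0⟩ : ∃ i, inner ℝ (Ω i).normal v = (Ω i).offset ∧ (Ω i).offset ≠ 0 := by
    by_contra! h
    exact hv0 (hv.eq_zero_of_forall_tight fun i hi => by rw [hi, h i hi])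
  refine ⟨(Ω i).offset, ?_, fun j => ?_, ⟨i, rfl, by rw [real_inner_comm, hit, one_mul]⟩,
    fun u k hu => ⟨k, ?_⟩⟩
  · rcases hc i with h | h | h
    · exact Or.inr ⟨h, i, h⟩
    · exact absurd h hi0
    · exact Or.inl h
  · rw [one_mul, real_inner_comm]
    exact (isVertex_iff.1 hv).1 _ ⟨j, rfl⟩
  · refine sub_eq_zero.1 (hv.eq_zero_of_forall_tight fun j hj => ?_)
    have := hu j (by rw [real_inner_comm, hj, one_mul])
    rw [inner_sub_right, real_inner_smul_right, hj, real_inner_comm, this, sub_self]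

end LinearConstraint

/-! ### The main theorem -/

open LinearConstraint in
theorem mainTheorem11 {V : Type*} [NormedAddCommGroup V] [InnerProductSpace ℝ V]
    [FiniteDimensional ℝ V] {ι : Type*} [Fintype ι]
    -- the constraint `Ω = ∑ ⟨αᵢ|cᵢ⟩` with `cᵢ ∈ {1, 0, -1}`
    (Ω : ι → LinearConstraint V)
    (hc : ∀ i, (Ω i).offset = 1 ∨ (Ω i).offset = 0 ∨ (Ω i).offset = -1)
    -- conventions on the elements of `Ω`
    (htriv : ∃ i, (Ω i).normal = 0 ∧ (Ω i).offset = -1)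
    (hzero : ∀ i, (Ω i).offset = 0 → (Ω i).normal ≠ 0)
    -- `rel(Ω)`
    (R : Finset (LinearConstraint V))
    (hR : IsMinimalRepresentation R (sat (Set.range Ω)))
    -- the minimal representations of `H^{(p)}_±`
    (p : ℕ) (hp : 1 < p)
    (L : ℝ → Finset (LinearConstraint V))
    (hL : ∀ s ∈ signs Ω, IsMinimalRepresentation (L s) (hullH Ω p s))
    -- `Ω` and `℧_±` are non-degenerate
    (hΩ : Nondegenerate (sat (Set.range Ω)))
    (hmho : ∀ s ∈ signs Ω, Nondegenerate (sat (setM Ω s (L s)))) :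
    -- (i) vertices of `reg_{±1}(Ω)`
    (∀ s ∈ signs Ω,
      (∀ i, (Ω i).offset = s →
        ((IsVertex (Ω i).normal (reg s Ω) ∧ (Ω i).normal ≠ 0) ↔ MemUpToNormalisation (Ω i) R)) ∧
      (∀ β, IsVertex β (reg s Ω) → β ≠ 0 → ∃ i, (Ω i).offset = s ∧ (Ω i).normal = β) ∧
      (∀ A ∈ R, 0 < s * A.offset → ∃ i, (Ω i).offset = s ∧ sat {Ω i} = sat {A})) ∧
    -- (ii) vertices of `sat(Ω)`
    ((∀ s ∈ signs Ω, ∀ A ∈ L s, A.offset ≠ 0 →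
        (IsVertex (|A.offset|⁻¹ • A.normal) (sat (Set.range Ω)) ↔ A ∈ setM Ω s (L s))) ∧
      (∀ v, IsVertex v (sat (Set.range Ω)) → v ≠ 0 →
        ∃ s ∈ signs Ω, ∃ A ∈ setM Ω s (L s), A.offset ≠ 0 ∧ |A.offset|⁻¹ • A.normal = v)) ∧
    -- (iii) facets of `reg_{±1}(Ω)`
    (∀ s ∈ signs Ω,
      (∀ A ∈ L s, (IsFacet (tightSet (reg s Ω) A) (reg s Ω) ↔ A ∈ setM Ω s (L s))) ∧
      (∀ F, IsFacet F (reg s Ω) → ∃ A ∈ setM Ω s (L s), F = tightSet (reg s Ω) A)) ∧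
    -- (iv) facets of `sat(Ω)`
    ((∀ A : LinearConstraint V,
        ((sat (Set.range Ω) ⊆ sat {A} ∧
          IsFacet (tightSet (sat (Set.range Ω)) A) (sat (Set.range Ω))) ↔
            MemUpToNormalisation A R)) ∧
      (∀ F, IsFacet F (sat (Set.range Ω)) →
        ∃ A ∈ R, F = tightSet (sat (Set.range Ω)) A)) := by
  have hss : ∀ s ∈ signs Ω, s * s = 1 ∧ ∃ i, (Ω i).offset = s := by
    rintro s (rfl | ⟨rfl, hi⟩)
    · obtain ⟨i, -, hi⟩ := htriv
      exact ⟨by norm_num, i, hi⟩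
    · exact ⟨by norm_num, hi⟩
  have hint := hΩ.interior_nonempty (convex_sat _)
  have hintH : ∀ s ∈ signs Ω, (interior (hullH Ω p s)).Nonempty := fun s hs =>
    interior_hullH_nonempty (hL s hs) (hmho s hs) (hss s hs).2
  refine ⟨fun s hs => ⟨fun i hi => ?_, fun β hβ hβ0 =>
    hβ.exists_normal_eq hc hint (hss s hs).1 hβ0, fun A hA hsA => ?_⟩,
    ⟨fun s hs A hA hA0 => isVertex_sat_iff_mem_setM hc htriv hp (hss s hs).1 (hL s hs)
      (hintH s hs) hA hA0, fun v hv hv0 => ?_⟩,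
    fun s hs => ⟨fun A hA => isFacet_tightSet_reg_iff hc htriv hp (hss s hs).1 (hL s hs)
      (hintH s hs) hA, fun F hF => hF.exists_mem_setM hc htriv hp (hss s hs).1 (hL s hs)
      (hintH s hs)⟩,
    subset_sat_and_isFacet_iff hR hΩ, fun F hF => hF.exists_mem_representation hR hΩ⟩
  · rw [memUpToNormalisation_iff hR hint]
    exact ⟨fun h => exists_isPosMultiple_of_isVertex_normal hR hint (hss s hs).1 hi h.1 h.2,
      fun ⟨B, hB, hBi⟩ => isVertex_normal_of_isPosMultiple hR hint (hss s hs).1 hi hB hBi⟩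
  · obtain ⟨i, hi⟩ := exists_isPosMultiple_of_mem hR hint hA
    refine ⟨i, ?_, hi.sat_eq⟩
    obtain ⟨t, ht, -, ho⟩ := hi
    have hpos : 0 < s * (Ω i).offset := by
      rw [ho]
      nlinarith [mul_pos ht hsA]
    rcases offset_cases (hc i) (hss s hs).1 with h | h | h
    · exact h
    · simp [h] at hpos
    · rw [h] at hpos
      nlinarith [(hss s hs).1]
  · obtain ⟨s, hs, hcf⟩ := hv.exists_isConeFacet hc hv0
    have hs1 := (hss s hs).1
    -- The cone facet has q = 1, which as a constraint on reg_s(Ω) has offset s because s² = 1.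
    obtain ⟨A, hA, t, ht, hn, ho⟩ := IsConeFacet.exists_mem_setM (A := ⟨v, s⟩) hc htriv hp hs1
      (hL s hs) (hintH s hs) hv0 (by rw [hs1]; exact hcf)
    have habs : |A.offset| = t := by
      rw [ho, abs_mul, abs_of_pos ht]
      rcases mul_self_eq_one_iff.1 hs1 with rfl | rfl <;> simp
    refine ⟨s, hs, A, hA, fun h => ?_, ?_⟩
    · rw [h, abs_zero] at habs
      exact ht.ne habs
    · rw [habs, hn, inv_smul_smul₀ ht.ne']
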